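/- Maps are composed from left to right. Let $X$ be a (finite or infinite) set with at least two elements and $|X|\neq 3$. Let $Sing(X)$ be the semigroup of all maps $X\to X$ that are neither injective nor surjective (for finite $X$: all non-invertible maps). *Categories with subobjects.* A small category $\mathcal C$ with subobjects is equipped with a subcategory of *inclusions* $j(c,d)$ on all objects which is a partial order (written $c\subseteq d$), consists of monomorphisms of $\mathcal C$, and is such that if $f=hg$ with $f,g$ inclusions, then $h$ is an inclusion. A *retraction* is a right inverse of an inclusion. A *normal factorization* of $f$ is $f=euj$ with $e$ a retraction, $u$ an isomorphism and $j$ an inclusion; $f^\circ=eu$. A *cone* $\gamma$ with vertex $c_\gamma$ assigns to each object $c$ a morphism $\gamma(c):c\to c_\gamma$ with $j(c,c')\gamma(c')=\gamma(c)$ for $c\subseteq c'$; it is *normal* if some $\gamma(c)$ is an isomorphism. $\mathcal C$ is *normal* if every morphism has a normal factorization, every inclusion has a right inverse, and for each object $c$ there is a cone $\gamma$ with vertex $c$ and $\gamma(c)=1_c$. For $f:c_\gamma\to d$ let $(\gamma * f^\circ)(c)=\gamma(c)f^\circ$. The set $T\mathcal C$ of normal cones has the product $\gamma\cdot\sigma=\gamma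 * (\sigma(c_\gamma))^\circ$. *Normal dual.* For $\gamma\in T\mathcal C$ let $H(\gamma;-):\mathcal C\to\mathbf{Set}$ be given by $H(\gamma;c)=\{\gamma * f^\circ : f\in\mathcal C(c_\gamma,c)\}$ and $H(\gamma;g):\gamma * f^\circ\mapsto\gamma * (fg)^\circ$; its $M$-set is $MH(\gamma;-)=\{c:\gamma(c)\text{ is an isomorphism}\}$. The normal dual $N^*\mathcal C$ has as objects the functors $H(\epsilon;-)$ with $\epsilon\in T\mathcal C$ idempotent and as morphisms all natural transformations; its inclusions are the inclusions of subfunctors. *Cross-connections.* A *local isomorphism* is an inclusion preserving, fully faithful functor $F$ that, for each object $c$, restricts to an isomorphism from the full subcategory of the subobjects of $c$ onto that of the subobjects of $F(c)$. A *cross-connection* from $\mathcal D$ to $\mathcal C$ (normal categories) is a local isomorphism $\Gamma:\mathcal D\to N^*\mathcal C$ such that each object $c$ of $\mathcal C$ lies in $M\Gamma(d)$ for some $d$. A *dual* of $\Gamma$ is a cross-connection $\Delta$ from $\mathcal C$ to $\mathcal D$ such that $c\in M\Gamma(d)\iff d\in M\Delta(c)$ for all $c,d$. Put $\Gamma(c,d)=\Gamma(d)(c)$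 and $\Delta(c,d)=\Delta(c)(d)$; these are bifunctors $\mathcal C\times\mathcal D\to\mathbf{Set}$. A *duality* is a natural isomorphism $\chi:\Gamma(-,-)\to\Delta(-,-)$. Given $\Gamma,\Delta,\chi$, the *cross-connection semigroup* $\tilde S\Gamma$ consists of all pairs $(\gamma,\delta)$ of linked cones, i.e. those with $\gamma\in\Gamma(c,d)$ and $\delta=\chi(c,d)(\gamma)$ for some $(c,d)$, with operation $(\gamma,\delta)\circ(\gamma',\delta')=(\gamma\cdot\gamma',\delta'\cdot\delta)$. *The two categories.* $\mathscr P(X)$ has as objects the non-empty proper subsets of $X$, as morphisms all functions between them, and as inclusions the inclusion maps. $\Pi(X)$ has as objects the partitions of $X$ other than the partition into singletons; a morphism $\eta^*:\pi_1\to\pi_2$ is given by a map $\eta$ from the set of blocks of $\pi_2$ to the set of blocks of $\pi_1$, with $\eta^*\mu^*=(\mu\eta)^*$ for $\mu:\pi_3\to\pi_2$ (first $\mu$, then $\eta$); there is an inclusion $\nu^*:\pi_1\to\pi_2$ exactly when $\pi_2$ refines $\pi_1$, and $\nu$ then sends each block of $\pi_2$ to the block of $\pi_1$ containing it. Both are normal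 categories. **Statement.** Let $\Gamma$ be any cross-connection from $\Pi(X)$ to $\mathscr P(X)$. Then $\Gamma$ has a dual $\Delta$ together with a duality $\chi$; and for every dual $\Delta$ of $\Gamma$ and every duality $\chi$, the set $\tilde S\Gamma$ of linked pairs is closed under $\circ$, and $\tilde S\Gamma$ is a semigroup isomorphic to $Sing(X)$. -/

import Mathlib

open CategoryTheory

universe u

namespace CrossConnection

/-! ### Categories with subobjects and normal categories

Composition `f ≫ g` of morphisms is written from left to right. -/

/-- A (small) category with subobjects: a choice of a subcategory of inclusions which contains all
objects, has at most one morphism between two objects and is antisymmetric (a strict preorder).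
`SubobjOf c d` says that there is an inclusion from `c` to `d`, and `incl` is this inclusion. -/
class SubobjectCategory (C : Type u) [SmallCategory C] where
  SubobjOf : C → C → Prop
  refl (c : C) : SubobjOf c c
  trans {c d e : C} : SubobjOf c d → SubobjOf d e → SubobjOf c e
  antisymm {c d : C} : SubobjOf c d → SubobjOf d c → c = d
  incl {c d : C} : SubobjOf c d → (c ⟶ d)
  incl_refl (c : C) : incl (refl c) = 𝟙 c
  incl_trans {c d e : C} (h : SubobjOf c d) (k : SubobjOf d e) :
    incl h ≫ incl k = incl (trans h k)
  incl_mono {c d : C} (h : SubobjOf c d) : Mono (incl h)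
  /-- If `f = h g` with inclusions `f` and `g`, then `h` is an inclusion. -/
  incl_of_comp {c d e : C} (f : SubobjOf c e) (h : c ⟶ d) (g : SubobjOf d e) :
    incl f = h ≫ incl g → ∃ k : SubobjOf c d, h = incl k

open SubobjectCategory

section Normal

variable {C : Type u} [SmallCategory C] [SubobjectCategory C]

/-- A normal factorization `f = e u j`: a retraction `e` (a right inverse of an inclusion),
an isomorphism `u` and an inclusion `j`. -/
structure NormalFactorization {c d : C} (f : c ⟶ d) where
  c' : C
  d' : C
  hc : SubobjOf c' c
  hd : SubobjOf d' d
  e : c ⟶ c'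
  he : incl hc ≫ e = 𝟙 c'
  u : c' ≅ d'
  fac : e ≫ u.hom ≫ incl hd = f

/-- The epimorphic component `e u` does not depend on the choice of the normal factorization. -/
theorem epi_component_unique {c d : C} {f : c ⟶ d} (N N' : NormalFactorization f) :
    ∃ h : N.d' = N'.d', (N.e ≫ N.u.hom) ≫ eqToHom h = N'.e ≫ N'.u.hom := by
  have key : ∀ M M' : NormalFactorization f, SubobjOf M.d' M'.d' := by
    intro M M'
    have h : incl M.hd = (M.u.inv ≫ incl M.hc ≫ M'.e ≫ M'.u.hom) ≫ incl M'.hd := by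
      have h2 : incl M.hc ≫ f = M.u.hom ≫ incl M.hd := by
        have := congrArg (fun k => incl M.hc ≫ k) M.fac
        rw [← this, ← Category.assoc, M.he, Category.id_comp]
      simp only [Category.assoc]
      rw [M'.fac, h2, Iso.inv_hom_id_assoc]
    exact (incl_of_comp _ _ _ h).1
  have h : N.d' = N'.d' := antisymm (key N N') (key N' N)
  refine ⟨h, ?_⟩
  obtain ⟨c', d', hc, hd, e, he, u, fac⟩ := N
  obtain ⟨c₁, d₁, hc₁, hd₁, e₁, he₁, u₁, fac₁⟩ := N'
  obtain rfl : d' = d₁ := h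
  have := incl_mono hd
  rw [← cancel_mono (incl hd)]
  simp [fac, fac₁]

/-- A cone from the set of all objects to the vertex `d`. -/
def IsCone {d : C} (γ : ∀ c : C, c ⟶ d) : Prop :=
  ∀ (c c' : C) (h : SubobjOf c c'), incl h ≫ γ c' = γ c

variable (C) in
/-- Normal categories. A cone `γ` with vertex `c` and `γ c = 𝟙 c` is automatically normal. -/
class NormalCategory : Prop where
  factor {c d : C} (f : c ⟶ d) : Nonempty (NormalFactorization f)
  split {c d : C} (h : SubobjOf c d) : ∃ e : d ⟶ c, incl h ≫ e = 𝟙 c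
  cone (c : C) : ∃ γ : ∀ c' : C, c' ⟶ c, IsCone γ ∧ γ c = 𝟙 c

variable (C) in
/-- Normal cones: cones with some component an isomorphism. -/
structure NormalCone where
  vertex : C
  app (c : C) : c ⟶ vertex
  isCone : IsCone app
  exists_isIso : ∃ c : C, IsIso (app c)

variable [NormalCategory C]

/-- A chosen normal factorization of `f`. Its epimorphic component `e u` does not depend on the
choice, by `epi_component_unique`. -/
noncomputable def factorization {c d : C} (f : c ⟶ d) : NormalFactorization f :=
  (NormalCategory.factor f).some

/-- The codomain of the epimorphic component of `f`. -/
noncomputable abbrev image {c d : C} (f : c ⟶ d) : C := (factorization f).d'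

theorem image_sub {c d : C} (f : c ⟶ d) : SubobjOf (image f) d := (factorization f).hd

/-- The epimorphic component `f° = e u` of `f = e u j`. -/
noncomputable def epiComp {c d : C} (f : c ⟶ d) : c ⟶ image f :=
  (factorization f).e ≫ (factorization f).u.hom

theorem epiComp_incl {c d : C} (f : c ⟶ d) : epiComp f ≫ incl (image_sub f) = f := by
  rw [epiComp, Category.assoc]
  exact (factorization f).fac

/-- The normal cone `γ * f°`, with components `γ c ≫ f°`. -/
noncomputable def NormalCone.star (γ : NormalCone C) {d : C} (f : γ.vertex ⟶ d) :
    NormalCone C where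
  vertex := image f
  app c := γ.app c ≫ epiComp f
  isCone c c' h := by rw [← Category.assoc, γ.isCone c c' h]
  exists_isIso := by
    obtain ⟨c₀, h₀⟩ := γ.exists_isIso
    let F := factorization f
    let N := factorization (incl F.hc ≫ inv (γ.app c₀))
    refine ⟨N.d', ?_⟩
    let t : N.d' ⟶ F.c' := incl N.hd ≫ γ.app c₀ ≫ F.e
    have h1 : N.e ≫ N.u.hom ≫ t = 𝟙 _ := by
      have := N.fac
      simp only [t]
      rw [← Category.assoc N.u.hom, ← Category.assoc N.e, this]
      simp [F.he]
    have h2 : N.u.hom ≫ t = incl N.hc := by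
      rw [← Category.id_comp (N.u.hom ≫ t), ← N.he, Category.assoc, h1, Category.comp_id]
    have h3 : IsIso (N.u.hom ≫ t) := ⟨N.e, by rw [h2, N.he], h1⟩
    have h4 : IsIso t := IsIso.of_isIso_comp_left N.u.hom t
    have h5 : γ.app N.d' ≫ epiComp f = t ≫ F.u.hom := by
      rw [← γ.isCone _ _ N.hd]
      simp only [t, epiComp, Category.assoc]
      rfl
    rw [h5]
    exact IsIso.comp_isIso

/-- The product of normal cones, `γ · σ = γ * (σ(c_γ))°`; this makes the set of normal cones
the semigroup `TC`. -/
noncomputable instance : Mul (NormalCone C) where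
  mul γ σ := γ.star (σ.app γ.vertex)

/-- The morphism `f : c_γ ⟶ c` is determined by the cone `γ * f°`. -/
theorem NormalCone.star_injective (γ : NormalCone C) {c : C} {f g : γ.vertex ⟶ c}
    (h : γ.star f = γ.star g) : f = g := by
  obtain ⟨c₀, h₀⟩ := γ.exists_isIso
  have key : ∀ (σ τ : NormalCone C) (hσ : SubobjOf σ.vertex c) (hτ : SubobjOf τ.vertex c),
      σ = τ → σ.app c₀ ≫ incl hσ = τ.app c₀ ≫ incl hτ := by
    rintro σ τ hσ hτ rfl
    rfl
  have := key _ _ (image_sub f) (image_sub g) h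
  simp only [NormalCone.star, Category.assoc, epiComp_incl] at this
  exact (cancel_epi (γ.app c₀)).1 this

end Normal

/-! ### The normal dual -/

section Dual

variable (C : Type u) [SmallCategory C] [SubobjectCategory C]

/-- Set-valued functors on `C` all of whose values are sets of normal cones. -/
structure ConeFunctor where
  obj (c : C) : Set (NormalCone C)
  map {c d : C} (g : c ⟶ d) : obj c → obj d
  map_id (c : C) (x : obj c) : map (𝟙 c) x = x
  map_comp {c d e : C} (g : c ⟶ d) (h : d ⟶ e) (x : obj c) : map (g ≫ h) x = map h (map g x)

variable {C}

/-- A `ConeFunctor` as a functor to the category of sets. -/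
def ConeFunctor.toFunctor (F : ConeFunctor C) : C ⥤ Type u where
  obj c := F.obj c
  map g := TypeCat.ofHom (F.map g)
  map_id c := by ext x; simp [F.map_id]
  map_comp g h := by ext x; simp [F.map_comp]

/-- `F` is a subfunctor of `G`: all `F c` are subsets of `G c`, and the inclusion maps form a
natural transformation. -/
def ConeFunctor.IsSubfunctor (F G : ConeFunctor C) : Prop :=
  ∃ h : ∀ c, F.obj c ⊆ G.obj c, ∀ {c d : C} (g : c ⟶ d) (x : F.obj c),
    (F.map g x : NormalCone C) = G.map g ⟨x, h c x.2⟩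

theorem ConeFunctor.IsSubfunctor.antisymm {F G : ConeFunctor C} (h : F.IsSubfunctor G)
    (k : G.IsSubfunctor F) : F = G := by
  obtain ⟨h₁, h₂⟩ := h
  obtain ⟨k₁, -⟩ := k
  obtain ⟨F, Fm, Fi, Fc⟩ := F
  obtain ⟨G, Gm, Gi, Gc⟩ := G
  obtain rfl : F = G := funext fun c => Set.Subset.antisymm (h₁ c) (k₁ c)
  have : @Fm = @Gm := by
    funext c d g x
    exact Subtype.ext (h₂ g x)
  subst this
  rfl

/-- The inclusion of a subfunctor, as a natural transformation. -/
def ConeFunctor.IsSubfunctor.incl {F G : ConeFunctor C} (h : F.IsSubfunctor G) :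
    F.toFunctor ⟶ G.toFunctor where
  app c := TypeCat.ofHom (fun x : F.obj c => (⟨x, h.1 c x.2⟩ : G.obj c))
  naturality c d g := by
    ext x
    exact Subtype.ext (h.2 g x)

variable [NormalCategory C]

/-- The `H`-functor `H(γ; -)`: `H(γ; c) = {γ * f° : f ∈ C(c_γ, c)}` and `H(γ; g)` maps
`γ * f°` to `γ * (f g)°` (see `H_map_star`). -/
noncomputable def H (γ : NormalCone C) : ConeFunctor C where
  obj c := Set.range fun f : γ.vertex ⟶ c => γ.star f
  map g x := ⟨γ.star (x.2.choose ≫ g), _, rfl⟩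
  map_id c x := Subtype.ext (by simpa using x.2.choose_spec)
  map_comp {c d e} g h x := Subtype.ext (by
    generalize_proofs h₁ h₂ h₃
    have : h₃.choose = h₁.choose ≫ g := γ.star_injective h₃.choose_spec
    simp only [this, Category.assoc])

theorem H_map_star (γ : NormalCone C) {c d : C} (f : γ.vertex ⟶ c) (g : c ⟶ d) :
    ((H γ).map g ⟨γ.star f, f, rfl⟩ : NormalCone C) = γ.star (f ≫ g) := by
  simp only [H]
  generalize_proofs h
  rw [γ.star_injective h.choose_spec]

variable (C) in
/-- The objects of the normal dual `N*C`: the functors `H(ε; -)` for idempotent normal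
cones `ε`. -/
def NormalDual : Type u :=
  {F : ConeFunctor C // ∃ ε : NormalCone C, IsIdempotentElem ε ∧ F = H ε}

/-- The morphisms of `N*C` are all natural transformations. -/
instance : SmallCategory (NormalDual C) where
  Hom F G := F.1.toFunctor ⟶ G.1.toFunctor
  id F := 𝟙 F.1.toFunctor
  comp f g := NatTrans.vcomp f g

variable (C) in
/-- The embedding of the normal dual into the category of functors from `C` to sets. -/
def NormalDual.toFunctor : NormalDual C ⥤ C ⥤ Type u where
  obj F := F.1.toFunctor
  map f := f

/-- The inclusions of `N*C` are the inclusions of subfunctors. -/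
instance : SubobjectCategory (NormalDual C) where
  SubobjOf F G := F.1.IsSubfunctor G.1
  refl F := ⟨fun _ => subset_rfl, fun _ _ => rfl⟩
  trans := by
    rintro F G K ⟨h₁, h₂⟩ ⟨k₁, k₂⟩
    exact ⟨fun c => (h₁ c).trans (k₁ c), fun g x => (h₂ g x).trans (k₂ g ⟨x, h₁ _ x.2⟩)⟩
  antisymm h k := Subtype.ext (h.antisymm k)
  incl h := h.incl
  incl_refl F := by
    refine NatTrans.ext (funext fun c => ?_)
    ext x
    rfl
  incl_trans h k := by
    refine NatTrans.ext (funext fun c => ?_)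
    ext x
    rfl
  incl_mono {F G} h := by
    refine ⟨fun {K} a b hab => ?_⟩
    refine NatTrans.ext (funext fun c => ?_)
    ext x
    have := congrArg (fun t : K.1.toFunctor ⟶ G.1.toFunctor => t.app c x) hab
    exact Subtype.ext (congrArg (fun y : G.1.obj c => (y : NormalCone C)) this)
  incl_of_comp {F G K} f h g hfg := by
    have key : ∀ c (x : F.1.obj c),
        ((show G.1.obj c from h.app c x) : NormalCone C) = (x : NormalCone C) := by
      intro c x
      have := congrArg (fun t : F.1.toFunctor ⟶ K.1.toFunctor => t.app c x) hfg
      exact (congrArg (fun y : K.1.obj c => (y : NormalCone C)) this).symm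
    have hsub : ∀ c, F.1.obj c ⊆ G.1.obj c := by
      intro c x hx
      have := (h.app c (⟨x, hx⟩ : F.1.obj c) : G.1.obj c).2
      rwa [key c ⟨x, hx⟩] at this
    have happ : ∀ c (x : F.1.obj c), h.app c x = (⟨x, hsub c x.2⟩ : G.1.obj c) :=
      fun c x => Subtype.ext (key c x)
    refine ⟨⟨hsub, fun {c d} k x => ?_⟩, ?_⟩
    · have := congrArg (fun t => t x) (h.naturality k)
      have h2 : h.app d (F.1.map k x) = G.1.map k (h.app c x) := this
      rw [happ c x] at h2
      rw [← h2, key]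
    · refine NatTrans.ext (funext fun c => ?_)
      ext x
      exact happ c x

/-- The `M`-set of an `H`-functor: `M H(γ; -) = {c : γ c is an isomorphism}`. -/
def MSet (F : NormalDual C) : Set C :=
  {c | ∃ γ : NormalCone C, F.1 = H γ ∧ IsIso (γ.app c)}

end Dual

/-! ### Cross-connections -/

section Cross

/-- Local isomorphisms: inclusion preserving, fully faithful functors which restrict to an
isomorphism from each ideal `⟨c⟩` (the full subcategory of the subobjects of `c`) onto the ideal
`⟨F c⟩`; since `F` is fully faithful, the latter means that `F` is bijective on the objects of the
ideals. -/
structure IsLocalIso {C D : Type u} [SmallCategory C] [SubobjectCategory C]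
    [SmallCategory D] [SubobjectCategory D] (F : C ⥤ D) : Prop where
  map_incl {c c' : C} (h : SubobjOf c c') :
    ∃ h' : SubobjOf (F.obj c) (F.obj c'), F.map (incl h) = incl h'
  full : F.Full
  faithful : F.Faithful
  ideal (c : C) : Set.BijOn F.obj {c' | SubobjOf c' c} {d | SubobjOf d (F.obj c)}

variable {C D : Type u} [SmallCategory C] [SubobjectCategory C] [NormalCategory C]
  [SmallCategory D] [SubobjectCategory D] [NormalCategory D]

/-- `Γ` is a cross-connection from `D` to `C`. -/
structure IsCrossConnection (Γ : D ⥤ NormalDual C) : Prop where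
  isLocalIso : IsLocalIso Γ
  total (c : C) : ∃ d : D, c ∈ MSet (Γ.obj d)

/-- `Δ` is the dual cross-connection of `Γ`: a cross-connection from `C` to `D` such that
`c ∈ MΓ(d)` if and only if `d ∈ MΔ(c)`. -/
structure IsDualOf (Δ : C ⥤ NormalDual D) (Γ : D ⥤ NormalDual C) : Prop where
  isCrossConnection : IsCrossConnection Δ
  mem_MSet_iff (c : C) (d : D) : c ∈ MSet (Γ.obj d) ↔ d ∈ MSet (Δ.obj c)

/-- The bifunctor `Γ(-,-) : C × D ⥤ Set`, `Γ(c, d) = Γ(d)(c)`, of a functor `Γ : D ⥤ N*C`. -/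
def bifunctor (Γ : D ⥤ NormalDual C) : C × D ⥤ Type u :=
  Functor.uncurry.obj (Γ ⋙ NormalDual.toFunctor C).flip

/-- The bifunctor `Δ(-,-) : C × D ⥤ Set`, `Δ(c, d) = Δ(c)(d)`, of a functor `Δ : C ⥤ N*D`. -/
def dualBifunctor (Δ : C ⥤ NormalDual D) : C × D ⥤ Type u :=
  Functor.uncurry.obj (Δ ⋙ NormalDual.toFunctor D)

/-- `UΓ`, the union of all the sets `Γ(c, d)` of normal cones in `C`. -/
def U (Γ : D ⥤ NormalDual C) : Set (NormalCone C) := ⋃ (c : C) (d : D), (Γ.obj d).1.obj c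

/-- The map `χ(c, d) : Γ(c, d) → Δ(c, d)` of a natural isomorphism `χ`. -/
def component {Γ : D ⥤ NormalDual C} {Δ : C ⥤ NormalDual D} (χ : bifunctor Γ ≅ dualBifunctor Δ)
    (c : C) (d : D) (γ : (Γ.obj d).1.obj c) : (Δ.obj c).1.obj d :=
  χ.hom.app (c, d) γ

/-- The cone `γ` is linked to the cone `δ` by the natural isomorphism `χ`: there is `(c, d)` with
`γ ∈ Γ(c, d)` and `δ = χ(c, d)(γ)`. -/
def Linked {Γ : D ⥤ NormalDual C} {Δ : C ⥤ NormalDual D} (χ : bifunctor Γ ≅ dualBifunctor Δ)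
    (γ : NormalCone C) (δ : NormalCone D) : Prop :=
  ∃ (c : C) (d : D) (hγ : γ ∈ (Γ.obj d).1.obj c),
    δ = component χ c d ⟨γ, hγ⟩

/-- The underlying set of the cross-connection semigroup: all linked pairs of cones. Its operation
`(γ, δ) ∘ (γ', δ') = (γ · γ', δ' · δ)` is the one of `TC × (TD)ᵒᵖ`. -/
def linkedPairs {Γ : D ⥤ NormalDual C} {Δ : C ⥤ NormalDual D}
    (χ : bifunctor Γ ≅ dualBifunctor Δ) : Set (NormalCone C × (NormalCone D)ᵐᵒᵖ) :=
  {p | p.1 ∈ U Γ ∧ p.2.unop ∈ U Δ ∧ Linked χ p.1 p.2.unop}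

end Cross

/-! ### The powerset category -/

/-- Objects of the powerset category: the non-empty proper subsets of `X`. -/
@[ext]
structure Powerset (X : Type u) where
  carrier : Set X
  nonempty : carrier.Nonempty
  ne_univ : carrier ≠ Set.univ

variable {X : Type u}

/-- The morphisms of the powerset category are all functions. -/
instance : SmallCategory (Powerset X) where
  Hom A B := A.carrier → B.carrier
  id _ := id
  comp f g := g ∘ f

/-- Subobjects in the powerset category are subsets. -/
instance : SubobjectCategory (Powerset X) where
  SubobjOf A B := A.carrier ⊆ B.carrier
  refl _ := subset_rfl
  trans := Set.Subset.trans
  antisymm h k := Powerset.ext (Set.Subset.antisymm h k)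
  incl h := Set.inclusion h
  incl_refl _ := rfl
  incl_trans _ _ := rfl
  incl_mono h := ⟨fun a b hab => funext fun x => Set.inclusion_injective h (congrFun hab x)⟩
  incl_of_comp {A B D} f h g hfg := by
    have key : ∀ x : A.carrier, ((h x : B.carrier) : X) = x := fun x =>
      (congrArg Subtype.val (congrFun hfg x)).symm
    refine ⟨fun x hx => ?_, funext fun x => Subtype.ext (key x)⟩
    have := (h ⟨x, hx⟩ : B.carrier).2
    rwa [key ⟨x, hx⟩] at this

instance : NormalCategory (Powerset X) where
  factor {A B} f := by
    classical
    let f' : A.carrier → B.carrier := f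
    let s : Set.range f' → A.carrier := fun b => b.2.choose
    have hs : ∀ b, f' (s b) = b := fun b => b.2.choose_spec
    let A' : Powerset X :=
      { carrier := Set.range fun b => (s b : X)
        nonempty := by
          obtain ⟨a, ha⟩ := A.nonempty
          exact ⟨_, ⟨f' ⟨a, ha⟩, _, rfl⟩, rfl⟩
        ne_univ := fun h => A.ne_univ (Set.eq_univ_of_univ_subset (h ▸ by
          rintro _ ⟨b, rfl⟩
          exact (s b).2)) }
    let B' : Powerset X :=
      { carrier := Set.range fun a => (f' a : X)
        nonempty := by
          obtain ⟨a, ha⟩ := A.nonempty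
          exact ⟨_, ⟨a, ha⟩, rfl⟩
        ne_univ := fun h => B.ne_univ (Set.eq_univ_of_univ_subset (h ▸ by
          rintro _ ⟨b, rfl⟩
          exact (f' b).2)) }
    have hA : A'.carrier ⊆ A.carrier := by
      rintro _ ⟨b, rfl⟩
      exact (s b).2
    have hB : B'.carrier ⊆ B.carrier := by
      rintro _ ⟨b, rfl⟩
      exact (f' b).2
    have hinv : ∀ x : A'.carrier, (s ⟨f' ⟨x, hA x.2⟩, _, rfl⟩ : X) = x := by
      rintro ⟨_, b, rfl⟩
      have : f' ⟨(s b : X), (s b).2⟩ = b := hs b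
      simp [this]
    exact ⟨{
      c' := A'
      d' := B'
      hc := hA
      hd := hB
      e := fun a => (⟨s ⟨f' a, a, rfl⟩, _, rfl⟩ : A'.carrier)
      he := funext fun x => Subtype.ext (hinv x)
      u :=
        { hom := fun x => (⟨f' ⟨x, hA x.2⟩, _, rfl⟩ : B'.carrier)
          inv := fun y => (⟨s ⟨⟨y, hB y.2⟩, by
            obtain ⟨_, a, rfl⟩ := y
            exact ⟨a, rfl⟩⟩, _, rfl⟩ : A'.carrier)
          hom_inv_id := funext fun x => Subtype.ext (hinv x)
          inv_hom_id := funext fun y => by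
            have hy : (⟨y, hB y.2⟩ : B.carrier) ∈ Set.range f' := by
              obtain ⟨_, a, rfl⟩ := y
              exact ⟨a, rfl⟩
            have h := congrArg Subtype.val (hs ⟨_, hy⟩)
            exact Subtype.ext h }
      fac := funext fun a => hs ⟨f' a, a, rfl⟩ }⟩
  split {A B} h := by
    classical
    refine ⟨fun b => if hb : (b : X) ∈ A.carrier then ⟨b, hb⟩
      else ⟨A.nonempty.choose, A.nonempty.choose_spec⟩, funext fun a => ?_⟩
    exact dif_pos a.2
  cone D := by
    classical
    refine ⟨fun A b => if hb : (b : X) ∈ D.carrier then ⟨b, hb⟩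
      else ⟨D.nonempty.choose, D.nonempty.choose_spec⟩, fun A B h => rfl, funext fun a => ?_⟩
    exact dif_pos a.2

/-! ### The category of partitions -/

/-- Objects of the category of partitions: the non-identity partitions of `X`, given by the
corresponding equivalence relations. The blocks of the partition are the elements of
`Quotient rel`. -/
@[ext]
structure Partitions (X : Type u) where
  rel : Setoid X
  ne_bot : rel ≠ ⊥

/-- A morphism `η* : π₁ ⟶ π₂` is given by a map `η` from the blocks of `π₂` to the blocks of
`π₁`. (If `X` has at least two elements, then `η` is determined by the map `η* : α ↦ η α` from the
functions `π₁ → X` to the functions `π₂ → X`.) -/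
instance : SmallCategory (Partitions X) where
  Hom p q := Quotient q.rel → Quotient p.rel
  id _ := id
  comp f g := f ∘ g

/-- The map which sends a block of `r` to the block of the coarser partition `s` containing it. -/
def blockMap {r s : Setoid X} (h : r ≤ s) : Quotient r → Quotient s :=
  Quotient.map id fun _ _ hab => h hab

theorem blockMap_surjective {r s : Setoid X} (h : r ≤ s) : Function.Surjective (blockMap h) := by
  rintro ⟨x⟩
  exact ⟨Quotient.mk r x, rfl⟩

/-- `π₁` is a subobject of `π₂` when `π₂` refines `π₁`; the inclusion is `ν*`, where `ν` sends a
block of `π₂` to the block of `π₁` containing it. -/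
instance : SubobjectCategory (Partitions X) where
  SubobjOf p q := q.rel ≤ p.rel
  refl _ := le_rfl
  trans h k := le_trans k h
  antisymm h k := Partitions.ext (le_antisymm k h)
  incl h := blockMap h
  incl_refl _ := by
    funext x
    induction x using Quotient.inductionOn
    rfl
  incl_trans _ _ := by
    funext x
    induction x using Quotient.inductionOn
    rfl
  incl_mono h := ⟨fun a b hab => funext fun x => by
    obtain ⟨y, rfl⟩ := blockMap_surjective h x
    exact congrFun hab y⟩
  incl_of_comp {p q r} f h g hfg := by
    have key : ∀ x : X, Quotient.mk p.rel x = h (Quotient.mk q.rel x) := fun x =>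
      congrFun hfg (Quotient.mk r.rel x)
    have hle : q.rel ≤ p.rel := fun {x y} hxy => by
      apply Quotient.exact (s := p.rel)
      rw [key x, key y, Quotient.sound (s := q.rel) hxy]
    refine ⟨hle, funext fun x => ?_⟩
    induction x using Quotient.inductionOn with
    | h x => exact (key x).symm

instance : NormalCategory (Partitions X) where
  factor {p q} f := by
    classical
    let η : Quotient q.rel → Quotient p.rel := f
    have hne : Nonempty X := by
      by_contra hX
      rw [not_nonempty_iff] at hX
      exact p.ne_bot (Setoid.ext fun x => isEmptyElim x)
    obtain ⟨x₀⟩ := hne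
    -- `r` is a retraction of the blocks of `p` onto the image of `η`.
    let r : Quotient p.rel → Quotient p.rel := fun a =>
      if a ∈ Set.range η then a else η (Quotient.mk _ x₀)
    have hr : ∀ a, r a ∈ Set.range η := by
      intro a
      simp only [r]
      split_ifs with h
      · exact h
      · exact ⟨_, rfl⟩
    have hrη : ∀ a, r (η a) = η a := fun a => if_pos ⟨a, rfl⟩
    have hrr : ∀ a, r (r a) = r a := fun a => if_pos (hr a)
    let s : Setoid X := Setoid.ker fun x => r (Quotient.mk p.rel x)
    let t : Setoid X := Setoid.ker fun x => η (Quotient.mk q.rel x)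
    have hps : p.rel ≤ s := fun {x y} hxy =>
      congrArg r (Quotient.sound (s := p.rel) hxy)
    have hqt : q.rel ≤ t := fun {x y} hxy =>
      congrArg η (Quotient.sound (s := q.rel) hxy)
    let c' : Partitions X := ⟨s, fun h => p.ne_bot (le_bot_iff.1 (h ▸ hps))⟩
    let d' : Partitions X := ⟨t, fun h => q.ne_bot (le_bot_iff.1 (h ▸ hqt))⟩
    let e : Quotient s → Quotient p.rel :=
      Quotient.lift (fun x => r (Quotient.mk p.rel x)) fun _ _ h => h
    have he : ∀ x, e (blockMap hps x) = r x := by rintro ⟨x⟩; rfl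
    have he' : ∀ x, blockMap hps (e x) = x := by
      rintro ⟨x⟩
      change blockMap hps (r (Quotient.mk p.rel x)) = Quotient.mk s x
      obtain ⟨z, hz⟩ := Quotient.exists_rep (r (Quotient.mk p.rel x))
      rw [← hz]
      refine Quotient.sound (s := s) ?_
      change r (Quotient.mk p.rel z) = r (Quotient.mk p.rel x)
      rw [hz, hrr]
    let m : Quotient t → Quotient p.rel :=
      Quotient.lift (fun x => η (Quotient.mk q.rel x)) fun _ _ h => h
    have hm : ∀ x, m (blockMap hqt x) = η x := by rintro ⟨x⟩; rfl
    have hmr : ∀ x, r (m x) = m x := by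
      rintro ⟨x⟩
      exact hrη _
    have hminj : Function.Injective m := by
      rintro ⟨x⟩ ⟨y⟩ h
      exact Quotient.sound (s := t) h
    let g : Quotient p.rel → Quotient t := fun a => blockMap hqt (hr a).choose
    have hg : ∀ a, m (g a) = r a := fun a => (hm _).trans (hr a).choose_spec
    have hre : ∀ x, r (e x) = e x := by
      rintro ⟨x⟩
      exact hrr _
    exact ⟨{
      c' := c'
      d' := d'
      hc := hps
      hd := hqt
      e := e
      he := funext he'
      u :=
        { hom := fun x => blockMap hps (m x)
          inv := fun x => g (e x)
          hom_inv_id := funext fun x => by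
            change blockMap hps (m (g (e x))) = x
            rw [hg, hre, he']
          inv_hom_id := funext fun x => by
            change g (e (blockMap hps (m x))) = x
            apply hminj
            rw [hg, he, hrr, hmr] }
      fac := funext fun x => by
        change e (blockMap hps (m (blockMap hqt x))) = f x
        rw [he, hmr, hm] }⟩
  split {p q} h :=
    ⟨Function.surjInv (blockMap_surjective h),
      funext fun x => Function.surjInv_eq (blockMap_surjective h) x⟩
  cone p := by
    refine ⟨fun q a => Quotient.mk q.rel (Quotient.out a), fun q q' h => rfl, ?_⟩
    exact funext fun a => Quotient.out_eq a

/-! ### Singular transformations -/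

/-- The singular transformations of `X`: the maps which are neither injective nor surjective.
For finite `X` these are exactly the non-invertible maps, see `singular_iff_not_bijective`. -/
def Sing (X : Type u) : Type u :=
  {a : X → X // ¬ Function.Injective a ∧ ¬ Function.Surjective a}

/-- The product of transformations: `x (a b) = (x a) b`. -/
instance : Semigroup (Sing X) where
  mul a b := ⟨b.1 ∘ a.1, fun h => a.2.1 h.of_comp, fun h => b.2.2 h.of_comp⟩
  mul_assoc _ _ _ := rfl

theorem singular_iff_not_bijective [Finite X] (a : X → X) :
    (¬ Function.Injective a ∧ ¬ Function.Surjective a) ↔ ¬ Function.Bijective a := by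
  rw [Finite.injective_iff_surjective, and_self, ← Finite.surjective_iff_bijective]

end CrossConnection

namespace CrossConnection

open SubobjectCategory

section

variable {X : Type u}

/-- The partition whose only blocks with more than one element are `F` and `G`. -/
def twoBlocks (F G : Set X) (hFG : Disjoint F G) : Setoid X where
  r x y := x = y ∨ (x ∈ F ∧ y ∈ F) ∨ (x ∈ G ∧ y ∈ G)
  iseqv := by
    have := Set.disjoint_left.1 hFG
    refine ⟨fun x => Or.inl rfl, fun h => by grind, fun h k => by grind⟩

/-- The partition whose only block with more than one element is `F`. -/
def oneBlock (F : Set X) : Setoid X where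
  r x y := x = y ∨ (x ∈ F ∧ y ∈ F)
  iseqv := ⟨fun x => Or.inl rfl, fun h => by grind, fun h k => by grind⟩

/-- The partition with the single non-trivial block `{a, b}`. -/
def pairPartition (a b : X) (hab : a ≠ b) : Partitions X where
  rel := oneBlock {a, b}
  ne_bot h := hab <| by
    have : oneBlock {a, b} a b := Or.inr (by simp)
    rw [h] at this
    exact this

theorem pairPartition_rel {a b : X} (hab : a ≠ b) {x y : X} :
    (pairPartition a b hab).rel x y ↔ x = y ∨ ((x = a ∨ x = b) ∧ (y = a ∨ y = b)) := Iff.rfl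

theorem Partitions.exists_ne (p : Partitions X) : ∃ a b, a ≠ b ∧ p.rel a b := by
  by_contra! h
  refine p.ne_bot (le_bot_iff.1 fun x y hxy => ?_)
  by_contra hne
  exact h x y hne hxy

/-- A choice of a block in every partition, compatible with refinement. -/
def IsThread (b : ∀ p : Partitions X, Quotient p.rel) : Prop :=
  ∀ (p q : Partitions X) (h : p.rel ≤ q.rel), blockMap h (b p) = b q

/-- `X` has at least four elements. -/
def HasFour (X : Type u) : Prop :=
  ∃ a b c d : X, a ≠ b ∧ a ≠ c ∧ a ≠ d ∧ b ≠ c ∧ b ≠ d ∧ c ≠ d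

theorem HasFour.exists_ne (h : HasFour X) (x y z : X) : ∃ w, w ≠ x ∧ w ≠ y ∧ w ≠ z := by
  obtain ⟨a, b, c, d, h⟩ := h
  by_contra hc
  have key : ∀ w, w = x ∨ w = y ∨ w = z := fun w => by
    by_contra! hw
    exact hc ⟨w, hw⟩
  have := key a
  have := key b
  have := key c
  have := key d
  grind

theorem hasFour_or [Nontrivial X] (hX : Nat.card X ≠ 3) :
    HasFour X ∨ ∀ x y z : X, x = y ∨ y = z ∨ x = z := by
  by_contra! h
  obtain ⟨h4, x, y, z, hxy, hyz, hxz⟩ := h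
  apply hX
  have : ∀ w : X, w = x ∨ w = y ∨ w = z := by
    intro w
    by_contra! hw
    exact h4 ⟨w, x, y, z, by tauto⟩
  rw [← Set.ncard_univ, Set.ncard_eq_three]
  exact ⟨x, y, z, hxy, hxz, hyz, by ext w; simpa using this w⟩

namespace IsThread

variable {b : ∀ p : Partitions X, Quotient p.rel}

theorem rel_of_le (hb : IsThread b) {p q : Partitions X} {s : Setoid X} (hp : p.rel ≤ s)
    (hq : q.rel ≤ s) {x y : X} (hx : b p = Quotient.mk _ x) (hy : b q = Quotient.mk _ y) :
    s x y := by
  let t : Partitions X := ⟨s, fun h => p.ne_bot (le_bot_iff.1 (h ▸ hp))⟩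
  have h1 := hb p t hp
  have h2 := hb q t hq
  rw [hx] at h1
  rw [hy] at h2
  exact Quotient.exact (s := s) (h1.trans h2.symm)

theorem rel_disjoint (hb : IsThread b) {c d e f : X} (hcd : c ≠ d) (hef : e ≠ f)
    (h1 : c ≠ e) (h2 : c ≠ f) (h3 : d ≠ e) (h4 : d ≠ f) {x y : X}
    (hx : b (pairPartition c d hcd) = Quotient.mk _ x)
    (hy : b (pairPartition e f hef) = Quotient.mk _ y) :
    x = y ∨ ((x = c ∨ x = d) ∧ (y = c ∨ y = d)) ∨ ((x = e ∨ x = f) ∧ (y = e ∨ y = f)) := by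
  have hdis : Disjoint ({c, d} : Set X) {e, f} := by
    rw [Set.disjoint_left]
    simp only [Set.mem_insert_iff, Set.mem_singleton_iff]
    grind
  refine hb.rel_of_le (s := twoBlocks {c, d} {e, f} hdis) ?_ ?_ hx hy
  · rintro u v (h | h)
    · exact Or.inl h
    · exact Or.inr (Or.inl h)
  · rintro u v (h | h)
    · exact Or.inl h
    · exact Or.inr (Or.inr h)

theorem rel_triple (hb : IsThread b) {c d e : X} (hcd : c ≠ d) (hce : c ≠ e) {x y : X}
    (hx : b (pairPartition c d hcd) = Quotient.mk _ x)
    (hy : b (pairPartition c e hce) = Quotient.mk _ y) :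
    x = y ∨ ((x = c ∨ x = d ∨ x = e) ∧ (y = c ∨ y = d ∨ y = e)) := by
  refine hb.rel_of_le (s := oneBlock {c, d, e}) ?_ ?_ hx hy
  · rintro u v (h | h)
    · exact Or.inl h
    · refine Or.inr ?_
      simp only [Set.mem_insert_iff, Set.mem_singleton_iff] at h ⊢
      tauto
  · rintro u v (h | h)
    · exact Or.inl h
    · refine Or.inr ?_
      simp only [Set.mem_insert_iff, Set.mem_singleton_iff] at h ⊢
      tauto

theorem swap {c d : X} (hcd : c ≠ d) {x : X}
    (h : b (pairPartition c d hcd) = Quotient.mk _ x) :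
    b (pairPartition d c hcd.symm) = Quotient.mk _ x := by
  have key : ∀ p q : Partitions X, p = q → b p = Quotient.mk _ x → b q = Quotient.mk _ x := by
    rintro p _ rfl h
    exact h
  refine key _ _ (Partitions.ext (Setoid.ext fun u v => ?_)) h
  simp only [pairPartition_rel]
  tauto

theorem pair_disjoint (hb : IsThread b) {c d e f : X} (hcd : c ≠ d) (hef : e ≠ f)
    (h1 : c ≠ e) (h2 : c ≠ f) (h3 : d ≠ e) (h4 : d ≠ f) {r : X} (hc : r ≠ c) (hd : r ≠ d)
    (hr : b (pairPartition c d hcd) = Quotient.mk _ r) :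
    b (pairPartition e f hef) = Quotient.mk _ r := by
  obtain ⟨y, hy⟩ := Quotient.exists_rep (b (pairPartition e f hef))
  have := hb.rel_disjoint hcd hef h1 h2 h3 h4 hr hy.symm
  rw [← hy]
  refine Quotient.sound ?_
  change (pairPartition e f hef).rel _ _
  rw [pairPartition_rel]
  grind

theorem pair_adjacent (hb : IsThread b) (h4 : HasFour X) {c d e : X} (hcd : c ≠ d) (hce : c ≠ e)
    (hde : d ≠ e) {r : X} (hc : r ≠ c) (hd : r ≠ d)
    (hr : b (pairPartition c d hcd) = Quotient.mk _ r) :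
    b (pairPartition c e hce) = Quotient.mk _ r := by
  obtain ⟨y, hy⟩ := Quotient.exists_rep (b (pairPartition c e hce))
  have h1 := hb.rel_triple hcd hce hr hy.symm
  have h2 : y ≠ d ∨ r ≠ e := by
    by_contra! hye
    obtain ⟨rfl, rfl⟩ := hye
    obtain ⟨z, hz1, hz2, hz3⟩ := h4.exists_ne c y r
    have h5 := hb.pair_disjoint hcd hz3.symm hce hz1.symm hde hz2.symm hc hd hr
    have h6 := hb.rel_triple hce.symm hz3.symm (swap _ hy.symm) h5
    grind
  rw [← hy]
  refine Quotient.sound ?_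
  change (pairPartition c e hce).rel _ _
  rw [pairPartition_rel]
  grind

theorem pair (hb : IsThread b) (h4 : HasFour X) {c d e f : X} (hcd : c ≠ d) (hef : e ≠ f)
    {r : X} (hc : r ≠ c) (hd : r ≠ d)
    (hr : b (pairPartition c d hcd) = Quotient.mk _ r) :
    b (pairPartition e f hef) = Quotient.mk _ r := by
  by_cases h1 : c = e
  · subst h1
    by_cases h2 : d = f
    · subst h2
      exact hr
    · exact hb.pair_adjacent h4 hcd hef h2 hc hd hr
  by_cases h2 : c = f
  · subst h2
    by_cases h3 : d = e
    · subst h3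
      exact swap _ hr
    · exact swap hef.symm (hb.pair_adjacent h4 hcd hef.symm h3 hc hd hr)
  by_cases h3 : d = e
  · subst h3
    exact hb.pair_adjacent h4 hcd.symm hef h2 hd hc (swap _ hr)
  by_cases h5 : d = f
  · subst h5
    exact swap hef.symm (hb.pair_adjacent h4 hcd.symm hef.symm h1 hd hc (swap _ hr))
  exact hb.pair_disjoint hcd hef h1 h2 h3 h5 hc hd hr

/-- If `X` has at least four elements, then every thread of blocks is given by a point. -/
theorem exists_point (hb : IsThread b) (h4 : HasFour X) :
    ∃ x : X, ∀ p : Partitions X, b p = Quotient.mk _ x := by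
  obtain ⟨r, hr⟩ : ∃ r, ∀ (e f : X) (h : e ≠ f), b (pairPartition e f h) = Quotient.mk _ r := by
    obtain ⟨c, d, e, f, h1, h2, h3, h5, h6, h7⟩ := h4
    obtain ⟨x, hx⟩ := Quotient.exists_rep (b (pairPartition c d h1))
    obtain ⟨y, hy⟩ := Quotient.exists_rep (b (pairPartition e f h7))
    have h4 : HasFour X := ⟨c, d, e, f, h1, h2, h3, h5, h6, h7⟩
    have := hb.rel_disjoint h1 h7 h2 h3 h5 h6 hx.symm hy.symm
    by_cases hxc : x ≠ c ∧ x ≠ d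
    · exact ⟨x, fun _ _ h => hb.pair h4 h1 h hxc.1 hxc.2 hx.symm⟩
    · have : y ≠ e ∧ y ≠ f := by grind
      exact ⟨y, fun _ _ h => hb.pair h4 h7 h this.1 this.2 hy.symm⟩
  refine ⟨r, fun p => ?_⟩
  obtain ⟨e, f, hef, h⟩ := p.exists_ne
  have hle : (pairPartition e f hef).rel ≤ p.rel := by
    rintro u v (rfl | ⟨rfl | rfl, rfl | rfl⟩)
    · exact p.rel.refl _
    · exact p.rel.refl _
    · exact h
    · exact p.rel.symm h
    · exact p.rel.refl _
  rw [← hb _ p hle, hr e f hef]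
  rfl

end IsThread

/-- Distinct points are separated by the partitions, if `X` has at least four elements. -/
theorem HasFour.eq_of_rel (h4 : HasFour X) {x y : X} (h : ∀ p : Partitions X, p.rel x y) :
    x = y := by
  by_contra hxy
  obtain ⟨z, hz, hz', -⟩ := h4.exists_ne x y x
  have := h (pairPartition x z hz.symm)
  rw [pairPartition_rel] at this
  grind

end

section

variable {X : Type u}

/-! ### Natural transformations between cone functors -/

section Transformations

variable {C : Type u} [SmallCategory C] [SubobjectCategory C]

theorem ConeFunctor.ext_of_eq {F G : ConeFunctor C} (h : ∀ c, F.obj c = G.obj c)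
    (hm : ∀ {c d : C} (g : c ⟶ d) (x : F.obj c) (y : G.obj c), (x : NormalCone C) = y →
      (F.map g x : NormalCone C) = G.map g y) : F = G :=
  ConeFunctor.IsSubfunctor.antisymm ⟨fun c => (h c).subset, fun g x => hm g x _ rfl⟩
    ⟨fun c => (h c).superset, fun g x => (hm g ⟨x, (h _).superset x.2⟩ x rfl).symm⟩

variable [NormalCategory C]

/-- An idempotent cone generating an object of the normal dual. -/
noncomputable def NormalDual.gen (F : NormalDual C) : NormalCone C := F.2.choose

theorem NormalDual.eq_H (F : NormalDual C) : F.1 = H F.gen := F.2.choose_spec.2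

/-- The component at `c` of a morphism of the normal dual, as a map of sets of cones. -/
def NormalDual.appl {F G : NormalDual C} (t : F ⟶ G) (c : C) (x : F.1.obj c) : G.1.obj c :=
  t.app c x

namespace NormalDual

variable {F G K : NormalDual C}

theorem hom_ext {s t : F ⟶ G} (h : ∀ c x, appl s c x = appl t c x) : s = t := by
  refine NatTrans.ext (funext fun c => ?_)
  ext x
  exact h c x

theorem appl_comp (s : F ⟶ G) (t : G ⟶ K) (c : C) (x : F.1.obj c) :
    appl (s ≫ t) c x = appl t c (appl s c x) := rfl

theorem appl_map (t : F ⟶ G) {c d : C} (g : c ⟶ d) (x : F.1.obj c) :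
    appl t d (F.1.map g x) = G.1.map g (appl t c x) :=
  congrArg (fun t => t x) (t.naturality g)

/-- A morphism of the normal dual from its components. -/
def homMk (a : ∀ c, F.1.obj c → G.1.obj c)
    (h : ∀ {c d : C} (g : c ⟶ d) x, a d (F.1.map g x) = G.1.map g (a c x)) : F ⟶ G :=
  show F.1.toFunctor ⟶ G.1.toFunctor from
  { app := fun c => TypeCat.ofHom (a c)
    naturality := fun c d g => by
      ext x
      exact h g x }

end NormalDual

end Transformations

/-! ### Normal cones in the powerset category -/

/-- A singleton, as an object of the powerset category. -/
def Powerset.point [Nontrivial X] (x : X) : Powerset X where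
  carrier := {x}
  nonempty := ⟨x, rfl⟩
  ne_univ h := by
    obtain ⟨y, hy⟩ := exists_ne x
    exact hy (h ▸ Set.mem_univ y : y ∈ ({x} : Set X))

/-- A morphism of the powerset category as a function. -/
def Powerset.toFun {A B : Powerset X} (f : A ⟶ B) : A.carrier → B.carrier := f

/-- A morphism of the category of partitions as a function on blocks. -/
def Partitions.toFun {p q : Partitions X} (f : p ⟶ q) : Quotient q.rel → Quotient p.rel := f

theorem Powerset.bijective_of_isIso {A B : Powerset X} (f : A ⟶ B) [IsIso f] :
    Function.Bijective (Powerset.toFun f) :=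
  Function.bijective_iff_has_inverse.2
    ⟨inv f, fun x => congrFun (IsIso.hom_inv_id f) x, fun x => congrFun (IsIso.inv_hom_id f) x⟩

theorem Powerset.isIso_of_bijective {A B : Powerset X} (f : A ⟶ B)
    (h : Function.Bijective (Powerset.toFun f)) : IsIso f := by
  obtain ⟨g, h1, h2⟩ := Function.bijective_iff_has_inverse.1 h
  exact ⟨g, funext h1, funext h2⟩

theorem Partitions.bijective_of_isIso {p q : Partitions X} (f : p ⟶ q) [IsIso f] :
    Function.Bijective (Partitions.toFun f) :=
  Function.bijective_iff_has_inverse.2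
    ⟨Partitions.toFun (inv f), fun x => congrFun (IsIso.inv_hom_id f) x,
      fun x => congrFun (IsIso.hom_inv_id f) x⟩

theorem Partitions.isIso_of_bijective {p q : Partitions X} (f : p ⟶ q)
    (h : Function.Bijective (Partitions.toFun f)) : IsIso f := by
  obtain ⟨g, h1, h2⟩ := Function.bijective_iff_has_inverse.1 h
  exact ⟨g, funext h2, funext h1⟩

namespace PowersetCone

variable [Nontrivial X]

/-- The transformation of `X` given by a cone in the powerset category. -/
def toMap (γ : NormalCone (Powerset X)) (x : X) : X :=
  (Powerset.toFun (γ.app (Powerset.point x)) ⟨x, rfl⟩).1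

theorem toMap_mem (γ : NormalCone (Powerset X)) (x : X) : toMap γ x ∈ γ.vertex.carrier :=
  (Powerset.toFun (γ.app (Powerset.point x)) ⟨x, rfl⟩).2

theorem app_apply (γ : NormalCone (Powerset X)) (A : Powerset X) (a : A.carrier) :
    (Powerset.toFun (γ.app A) a).1 = toMap γ a := by
  have h : SubobjOf (Powerset.point a.1) A := Set.singleton_subset_iff.2 a.2
  have := congrFun (γ.isCone _ _ h) ⟨a.1, rfl⟩
  exact congrArg Subtype.val this

theorem range_toMap (γ : NormalCone (Powerset X)) : Set.range (toMap γ) = γ.vertex.carrier := by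
  refine Set.Subset.antisymm ?_ fun y hy => ?_
  · rintro _ ⟨x, rfl⟩
    exact toMap_mem γ x
  · obtain ⟨A, hA⟩ := γ.exists_isIso
    obtain ⟨a, ha⟩ := (Powerset.bijective_of_isIso (γ.app A)).2 ⟨y, hy⟩
    exact ⟨a, by rw [← app_apply, ha]⟩

theorem isIso_app_iff (γ : NormalCone (Powerset X)) (A : Powerset X) :
    IsIso (γ.app A) ↔ ∀ x, ∃! a, a ∈ A.carrier ∧ toMap γ a = toMap γ x := by
  constructor
  · intro h x
    have hb := Powerset.bijective_of_isIso (γ.app A)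
    obtain ⟨a, ha⟩ := hb.2 ⟨toMap γ x, toMap_mem γ x⟩
    refine ⟨a, ⟨a.2, by rw [← app_apply, ha]⟩, ?_⟩
    rintro c ⟨hc, hcx⟩
    refine congrArg Subtype.val (hb.1 (a₁ := ⟨c, hc⟩) (Subtype.ext ?_))
    rw [ha, app_apply, hcx]
  · intro h
    refine Powerset.isIso_of_bijective _ ⟨fun a c hac => ?_, fun y => ?_⟩
    · have h1 := congrArg Subtype.val hac
      rw [app_apply, app_apply] at h1
      exact Subtype.ext ((h a).unique ⟨a.2, rfl⟩ ⟨c.2, h1.symm⟩)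
    · obtain ⟨x, hx⟩ := (range_toMap γ).superset y.2
      obtain ⟨a, ⟨ha, hax⟩, -⟩ := h x
      exact ⟨⟨a, ha⟩, Subtype.ext (by rw [app_apply, hax, hx])⟩

theorem toMap_injective : Function.Injective (toMap (X := X)) := by
  intro γ δ h
  have hv : γ.vertex = δ.vertex := Powerset.ext (by rw [← range_toMap, ← range_toMap, h])
  have happ : ∀ A a, (Powerset.toFun (γ.app A) a).1 = (Powerset.toFun (δ.app A) a).1 := by
    intro A a
    rw [app_apply, app_apply, h]
  obtain ⟨v, a, h1, h2⟩ := γ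
  obtain ⟨w, b, h3, h4⟩ := δ
  obtain rfl : v = w := hv
  obtain rfl : a = b := funext fun A => funext fun x => Subtype.ext (happ A x)
  rfl

theorem toMap_not_injective (γ : NormalCone (Powerset X)) : ¬ Function.Injective (toMap γ) := by
  intro h
  obtain ⟨A, hA⟩ := γ.exists_isIso
  rw [isIso_app_iff] at hA
  refine A.ne_univ (Set.eq_univ_of_forall fun x => ?_)
  obtain ⟨a, ⟨ha, hax⟩, -⟩ := hA x
  exact h hax ▸ ha

theorem toMap_not_surjective (γ : NormalCone (Powerset X)) : ¬ Function.Surjective (toMap γ) := by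
  rw [← Set.range_eq_univ, range_toMap]
  exact γ.vertex.ne_univ

/-- The cone in the powerset category given by a singular transformation. -/
noncomputable def ofMap (a : X → X) (h1 : ¬ Function.Injective a) (h2 : ¬ Function.Surjective a) :
    NormalCone (Powerset X) where
  vertex := ⟨Set.range a, Set.range_nonempty a, fun h => h2 (Set.range_eq_univ.1 h)⟩
  app A := fun x => (⟨a x.1, x.1, rfl⟩ : Set.range a)
  isCone A B h := rfl
  exists_isIso := by
    let s : Set.range a → X := fun y => y.2.choose
    have hs : ∀ y, a (s y) = y := fun y => y.2.choose_spec
    refine ⟨⟨Set.range s, ⟨_, ⟨a (Classical.arbitrary X), _, rfl⟩, rfl⟩, fun h => h1 ?_⟩,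
      Powerset.isIso_of_bijective _ ⟨?_, ?_⟩⟩
    · intro x y hxy
      obtain ⟨x', rfl⟩ := Set.range_eq_univ.1 h x
      obtain ⟨y', rfl⟩ := Set.range_eq_univ.1 h y
      rw [hs, hs] at hxy
      rw [Subtype.ext hxy]
    · rintro ⟨_, x, rfl⟩ ⟨_, y, rfl⟩ hxy
      have : a (s x) = a (s y) := congrArg Subtype.val hxy
      rw [hs, hs] at this
      exact Subtype.ext (congrArg s (Subtype.ext this))
    · rintro y
      exact ⟨⟨s y, y, rfl⟩, Subtype.ext (hs y)⟩

theorem toMap_ofMap (a : X → X) (h1 : ¬ Function.Injective a) (h2 : ¬ Function.Surjective a) :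
    toMap (ofMap a h1 h2) = a := rfl

theorem toMap_star (γ : NormalCone (Powerset X)) {A : Powerset X} (f : γ.vertex ⟶ A) (x : X) :
    toMap (γ.star f) x = Powerset.toFun f ⟨toMap γ x, toMap_mem γ x⟩ := by
  have := congrFun (epiComp_incl f) ⟨toMap γ x, toMap_mem γ x⟩
  exact congrArg Subtype.val this

theorem toMap_mul (γ δ : NormalCone (Powerset X)) : toMap (γ * δ) = toMap δ ∘ toMap γ := by
  funext x
  exact (toMap_star γ _ x).trans (app_apply δ _ _)

theorem mem_H_iff {γ δ : NormalCone (Powerset X)} {A : Powerset X} :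
    δ ∈ (H γ).obj A ↔
      Set.range (toMap δ) ⊆ A.carrier ∧ Setoid.ker (toMap γ) ≤ Setoid.ker (toMap δ) := by
  constructor
  · rintro ⟨f, rfl⟩
    refine ⟨?_, fun x y hxy => ?_⟩
    · rintro _ ⟨x, rfl⟩
      dsimp only
      rw [toMap_star]
      exact Subtype.prop _
    · change toMap (γ.star f) x = toMap (γ.star f) y
      have : toMap γ x = toMap γ y := hxy
      simp only [toMap_star, this]
  · rintro ⟨h1, h2⟩
    have hs : ∀ y : γ.vertex.carrier, ∃ x, toMap γ x = y := fun y => (range_toMap γ).superset y.2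
    choose s hs using hs
    let f : γ.vertex ⟶ A := fun y => (⟨toMap δ (s y), h1 ⟨_, rfl⟩⟩ : A.carrier)
    refine ⟨f, toMap_injective (funext fun x => ?_)⟩
    dsimp only
    rw [toMap_star]
    exact h2 (hs _)

theorem toMap_H_map (γ : NormalCone (Powerset X)) {A B : Powerset X} (g : A ⟶ B)
    (δ : (H γ).obj A) (x : X) (hx : toMap δ.1 x ∈ A.carrier) :
    toMap ((H γ).map g δ).1 x = Powerset.toFun g ⟨toMap δ.1 x, hx⟩ := by
  obtain ⟨_, f, rfl⟩ := δ
  rw [H_map_star, toMap_star]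
  refine congrArg (fun y => (Powerset.toFun g y).1) (Subtype.ext ?_)
  exact (toMap_star γ f x).symm

end PowersetCone

/-! ### The normal dual of the powerset category -/

namespace PowersetDual

open PowersetCone NormalDual

variable [Nontrivial X]

/-- The partition corresponding to an object of the normal dual of the powerset category. -/
noncomputable def part (F : NormalDual (Powerset X)) : Partitions X where
  rel := Setoid.ker (toMap F.gen)
  ne_bot h := toMap_not_injective _ (Setoid.injective_iff_ker_bot _ |>.2 h)

theorem mem_iff {F : NormalDual (Powerset X)} {A : Powerset X} {δ : NormalCone (Powerset X)} :
    δ ∈ F.1.obj A ↔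
      Set.range (toMap δ) ⊆ A.carrier ∧ (part F).rel ≤ Setoid.ker (toMap δ) := by
  rw [F.eq_H]
  exact mem_H_iff

theorem mem_carrier {F : NormalDual (Powerset X)} {A : Powerset X} (δ : F.1.obj A) (x : X) :
    toMap δ.1 x ∈ A.carrier := (mem_iff.1 δ.2).1 ⟨x, rfl⟩

theorem toMap_map (F : NormalDual (Powerset X)) {A B : Powerset X} (g : A ⟶ B)
    (δ : F.1.obj A) (x : X) :
    toMap (F.1.map g δ).1 x = Powerset.toFun g ⟨toMap δ.1 x, mem_carrier δ x⟩ := by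
  have key : ∀ (G : ConeFunctor (Powerset X)) (_ : G = H F.gen) (δ : G.obj A)
      (hx : toMap δ.1 x ∈ A.carrier),
      toMap (G.map g δ).1 x = Powerset.toFun g ⟨toMap δ.1 x, hx⟩ := by
    rintro _ rfl δ hx
    exact toMap_H_map _ g δ x hx
  exact key F.1 (eq_H F) δ _

theorem part_rel_eq {F : NormalDual (Powerset X)} {γ : NormalCone (Powerset X)}
    (h : F.1 = H γ) : (part F).rel = Setoid.ker (toMap γ) := by
  have h1 : γ ∈ F.1.obj γ.vertex := by
    rw [h, mem_H_iff]
    exact ⟨(range_toMap γ).subset, le_rfl⟩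
  have h2 : F.gen ∈ (H γ).obj F.gen.vertex := by
    rw [← h, F.eq_H, mem_H_iff]
    exact ⟨(range_toMap _).subset, le_rfl⟩
  exact le_antisymm (mem_iff.1 h1).2 (mem_H_iff.1 h2).2

theorem subobjOf_iff {F G : NormalDual (Powerset X)} :
    SubobjOf F G ↔ (part G).rel ≤ (part F).rel := by
  constructor
  · rintro ⟨h, -⟩
    have h2 : F.gen ∈ F.1.obj F.gen.vertex := by
      rw [F.eq_H, mem_H_iff]
      exact ⟨(range_toMap _).subset, le_rfl⟩
    exact (mem_iff.1 (h _ h2)).2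
  · intro h
    refine ⟨fun A τ hτ => ?_, fun {A B} g x => toMap_injective (funext fun z => ?_)⟩
    · rw [mem_iff] at hτ ⊢
      exact ⟨hτ.1, h.trans hτ.2⟩
    · rw [toMap_map, toMap_map]

/-- Every non-identity partition is the kernel of an idempotent cone. -/
theorem exists_idempotent (p : Partitions X) :
    ∃ ε : NormalCone (Powerset X), IsIdempotentElem ε ∧ Setoid.ker (toMap ε) = p.rel := by
  let a : X → X := fun x => (Quotient.mk p.rel x).out
  have ha : ∀ x y, a x = a y ↔ p.rel x y := fun x y =>
    ⟨fun h => Quotient.exact (s := p.rel) (Quotient.out_injective h),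
      fun h => congrArg Quotient.out (Quotient.sound (s := p.rel) h)⟩
  have haa : ∀ x, a (a x) = a x := fun x => congrArg Quotient.out (Quotient.out_eq _)
  have h1 : ¬ Function.Injective a := fun h => p.ne_bot <| le_bot_iff.1 fun {x y} hxy =>
    h ((ha x y).2 hxy)
  have h2 : ¬ Function.Surjective a := fun h => h1 fun x y hxy => by
    obtain ⟨x, rfl⟩ := h x
    obtain ⟨y, rfl⟩ := h y
    rwa [haa, haa] at hxy
  refine ⟨ofMap a h1 h2, toMap_injective ?_, Setoid.ext ha⟩
  rw [toMap_mul, toMap_ofMap]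
  exact funext haa

/-- The object of the normal dual corresponding to a partition. -/
theorem exists_part_eq (p : Partitions X) : ∃ F : NormalDual (Powerset X), part F = p := by
  obtain ⟨ε, h, hp⟩ := exists_idempotent p
  exact ⟨⟨H ε, ε, h, rfl⟩, Partitions.ext ((part_rel_eq (γ := ε) rfl).trans hp)⟩

theorem mem_MSet_iff {F : NormalDual (Powerset X)} {A : Powerset X} :
    A ∈ MSet F ↔ ∀ x, ∃! a, a ∈ A.carrier ∧ (part F).rel a x := by
  constructor
  · rintro ⟨γ, hγ, h⟩
    rw [part_rel_eq hγ]
    exact (isIso_app_iff γ A).1 h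
  · intro h
    exact ⟨_, eq_H F, (isIso_app_iff _ A).2 h⟩

end PowersetDual

end

section

variable {X : Type u}

/-! ### Normal cones in the category of partitions -/

namespace PartitionCone

theorem isThread (σ : NormalCone (Partitions X)) (q : Quotient σ.vertex.rel) :
    IsThread fun p => Partitions.toFun (σ.app p) q :=
  fun p p' h => congrFun (σ.isCone p' p h) q

variable [h4 : Fact (HasFour X)]

/-- The transformation of `X` given by a cone in the category of partitions. -/
noncomputable def toMap (σ : NormalCone (Partitions X)) (x : X) : X :=
  ((isThread σ (Quotient.mk _ x)).exists_point h4.out).choose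

theorem app_apply (σ : NormalCone (Partitions X)) (p : Partitions X) (x : X) :
    Partitions.toFun (σ.app p) (Quotient.mk _ x) = Quotient.mk _ (toMap σ x) :=
  ((isThread σ (Quotient.mk _ x)).exists_point h4.out).choose_spec p

theorem toMap_eq_of_rel (σ : NormalCone (Partitions X)) {x y : X} (h : σ.vertex.rel x y) :
    toMap σ x = toMap σ y :=
  h4.out.eq_of_rel fun p => by
    apply Quotient.exact (s := p.rel)
    rw [← app_apply, ← app_apply, Quotient.sound (s := σ.vertex.rel) h]

theorem ker_toMap (σ : NormalCone (Partitions X)) :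
    Setoid.ker (toMap σ) = σ.vertex.rel := by
  refine le_antisymm (fun {x y} h => ?_) fun {x y} h => toMap_eq_of_rel σ h
  obtain ⟨p, hp⟩ := σ.exists_isIso
  refine Quotient.exact (s := σ.vertex.rel) ((Partitions.bijective_of_isIso (σ.app p)).1 ?_)
  rw [app_apply, app_apply]
  exact congrArg _ h

theorem isIso_app_iff (σ : NormalCone (Partitions X)) (p : Partitions X) :
    IsIso (σ.app p) ↔ ∀ x, ∃! a, a ∈ Set.range (toMap σ) ∧ p.rel a x := by
  constructor
  · intro h x
    have hb := Partitions.bijective_of_isIso (σ.app p)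
    obtain ⟨q, hq⟩ := hb.2 (Quotient.mk _ x)
    obtain ⟨y, rfl⟩ := Quotient.exists_rep q
    rw [app_apply] at hq
    refine ⟨toMap σ y, ⟨⟨y, rfl⟩, Quotient.exact hq⟩, ?_⟩
    rintro _ ⟨⟨z, rfl⟩, hz⟩
    refine toMap_eq_of_rel σ (Quotient.exact (hb.1 ?_))
    rw [app_apply, app_apply, hq]
    exact Quotient.sound hz
  · intro h
    refine Partitions.isIso_of_bijective _ ⟨fun q q' hq => ?_, fun q => ?_⟩
    · obtain ⟨x, rfl⟩ := Quotient.exists_rep q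
      obtain ⟨y, rfl⟩ := Quotient.exists_rep q'
      rw [app_apply, app_apply] at hq
      have h1 : toMap σ x = toMap σ y :=
        (h (toMap σ y)).unique ⟨⟨x, rfl⟩, Quotient.exact hq⟩ ⟨⟨y, rfl⟩, p.rel.refl _⟩
      exact Quotient.sound ((ker_toMap σ).le h1)
    · obtain ⟨x, rfl⟩ := Quotient.exists_rep q
      obtain ⟨_, ⟨⟨y, rfl⟩, hy⟩, -⟩ := h x
      exact ⟨Quotient.mk _ y, by rw [app_apply]; exact Quotient.sound hy⟩

theorem toMap_injective : Function.Injective (toMap (X := X)) := by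
  intro σ τ h
  have hv : σ.vertex = τ.vertex := Partitions.ext (by rw [← ker_toMap, ← ker_toMap, h])
  have happ : ∀ p x, Partitions.toFun (σ.app p) (Quotient.mk _ x) =
      Partitions.toFun (τ.app p) (Quotient.mk _ x) := by
    intro p x
    rw [app_apply, app_apply, h]
  obtain ⟨v, a, h1, h2⟩ := σ
  obtain ⟨w, b, h3, h4⟩ := τ
  obtain rfl : v = w := hv
  obtain rfl : a = b := funext fun p => funext fun q => by
    obtain ⟨x, rfl⟩ := Quotient.exists_rep q
    exact happ p x
  rfl

theorem toMap_not_surjective (σ : NormalCone (Partitions X)) :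
    ¬ Function.Surjective (toMap σ) := by
  intro h
  obtain ⟨p, hp⟩ := σ.exists_isIso
  rw [isIso_app_iff] at hp
  obtain ⟨a, b, hab, hr⟩ := p.exists_ne
  exact hab ((hp b).unique ⟨h a, hr⟩ ⟨h b, p.rel.refl _⟩)

/-- The cone in the category of partitions given by a singular transformation. -/
noncomputable def ofMap (a : X → X) (h1 : ¬ Function.Injective a) (h2 : ¬ Function.Surjective a) :
    NormalCone (Partitions X) where
  vertex := ⟨Setoid.ker a, fun h => h1 ((Setoid.injective_iff_ker_bot _).2 h)⟩
  app p := Quotient.lift (fun x => Quotient.mk p.rel (a x)) fun _ _ h => congrArg _ h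
  isCone p p' h := by
    funext q
    obtain ⟨x, rfl⟩ := Quotient.exists_rep q
    rfl
  exists_isIso := by
    classical
    have hX : ∃ x, x ∉ Set.range a := by
      by_contra! h
      exact h2 h
    obtain ⟨x₀, hx₀⟩ := hX
    let r : X → X := fun y => if y ∈ Set.range a then y else a x₀
    have hr : ∀ x, r (a x) = a x := fun x => if_pos ⟨x, rfl⟩
    have hr' : ∀ x, ∃ y, r x = a y := fun x => by
      by_cases h : x ∈ Set.range a
      · exact ⟨h.choose, (if_pos h).trans h.choose_spec.symm⟩
      · exact ⟨x₀, if_neg h⟩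
    have hne : Setoid.ker r ≠ ⊥ := fun h => hx₀ <| by
      have h3 := (Setoid.injective_iff_ker_bot r).2 h
      have h4 : r x₀ = a x₀ := if_neg hx₀
      exact ⟨x₀, h3 ((hr x₀).trans h4.symm)⟩
    refine ⟨⟨Setoid.ker r, hne⟩, Partitions.isIso_of_bijective _ ⟨fun q q' hq => ?_, fun q => ?_⟩⟩
    · obtain ⟨x, rfl⟩ := Quotient.exists_rep q
      obtain ⟨y, rfl⟩ := Quotient.exists_rep q'
      have h3 : r (a x) = r (a y) := Quotient.exact (s := Setoid.ker r) hq
      rw [hr, hr] at h3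
      exact Quotient.sound (s := Setoid.ker a) h3
    · obtain ⟨x, rfl⟩ := Quotient.exists_rep q
      obtain ⟨y, hy⟩ := hr' x
      exact ⟨Quotient.mk (Setoid.ker a) y,
        Quotient.sound (s := Setoid.ker r) ((hr y).trans hy.symm)⟩

theorem toMap_ofMap (a : X → X) (h1 : ¬ Function.Injective a) (h2 : ¬ Function.Surjective a) :
    toMap (ofMap a h1 h2) = a := by
  funext x
  refine h4.out.eq_of_rel fun p => ?_
  apply Quotient.exact (s := p.rel)
  rw [← app_apply]
  rfl

theorem toMap_star (σ : NormalCone (Partitions X)) {p : Partitions X} (f : σ.vertex ⟶ p)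
    {x y : X} (h : Partitions.toFun f (Quotient.mk _ x) = Quotient.mk _ y) :
    toMap (σ.star f) x = toMap σ y := by
  refine h4.out.eq_of_rel fun q => ?_
  apply Quotient.exact (s := q.rel)
  rw [← app_apply, ← app_apply, ← h]
  have := congrFun (epiComp_incl f) (Quotient.mk _ x)
  exact congrArg (Partitions.toFun (σ.app q)) this

theorem toMap_mul (σ τ : NormalCone (Partitions X)) : toMap (σ * τ) = toMap σ ∘ toMap τ := by
  funext x
  exact toMap_star σ _ (app_apply τ _ x)

theorem mem_H_iff {σ τ : NormalCone (Partitions X)} {p : Partitions X} :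
    τ ∈ (H σ).obj p ↔
      Set.range (toMap τ) ⊆ Set.range (toMap σ) ∧ p.rel ≤ Setoid.ker (toMap τ) := by
  constructor
  · rintro ⟨f, rfl⟩
    refine ⟨?_, fun {x y} hxy => ?_⟩
    · rintro _ ⟨x, rfl⟩
      obtain ⟨y, hy⟩ := Quotient.exists_rep (Partitions.toFun f (Quotient.mk _ x))
      exact ⟨y, (toMap_star σ f hy.symm).symm⟩
    · obtain ⟨z, hz⟩ := Quotient.exists_rep (Partitions.toFun f (Quotient.mk _ x))
      change toMap (σ.star f) x = toMap (σ.star f) y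
      rw [toMap_star σ f hz.symm, toMap_star σ f (x := y) (y := z)]
      rw [hz, Quotient.sound (s := p.rel) hxy]
  · rintro ⟨h1, h2⟩
    have hs : ∀ x, ∃ y, toMap σ y = toMap τ x := fun x => h1 ⟨x, rfl⟩
    choose s hs using hs
    let f : σ.vertex ⟶ p := Quotient.lift (fun x => Quotient.mk σ.vertex.rel (s x)) fun x y hxy => by
      refine Quotient.sound (s := σ.vertex.rel) ((ker_toMap σ).le ?_)
      change toMap σ (s x) = toMap σ (s y)
      rw [hs, hs]
      exact h2 hxy
    refine ⟨f, toMap_injective (funext fun x => ?_)⟩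
    exact (toMap_star σ f (y := s x) rfl).trans (hs x)

theorem toMap_H_map (σ : NormalCone (Partitions X)) {p q : Partitions X} (g : p ⟶ q)
    (τ : (H σ).obj p) {x y : X} (h : Partitions.toFun g (Quotient.mk _ x) = Quotient.mk _ y) :
    toMap ((H σ).map g τ).1 x = toMap τ.1 y := by
  obtain ⟨_, f, rfl⟩ := τ
  obtain ⟨z, hz⟩ := Quotient.exists_rep (Partitions.toFun f (Quotient.mk _ y))
  rw [H_map_star, toMap_star σ (f ≫ g) (y := z)]
  · exact (toMap_star σ f hz.symm).symm
  · rw [hz, ← h]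
    rfl

end PartitionCone

/-! ### The normal dual of the category of partitions -/

namespace PartitionDual

open PartitionCone NormalDual

variable [h4 : Fact (HasFour X)]

theorem toMap_map (F : NormalDual (Partitions X)) {p q : Partitions X} (g : p ⟶ q)
    (τ : F.1.obj p) {x y : X} (h : Partitions.toFun g (Quotient.mk _ x) = Quotient.mk _ y) :
    toMap (F.1.map g τ).1 x = toMap τ.1 y := by
  have key : ∀ (G : ConeFunctor (Partitions X)) (_ : G = H F.gen) (τ : G.obj p),
      toMap (G.map g τ).1 x = toMap τ.1 y := by
    rintro _ rfl τ
    exact toMap_H_map _ g τ h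
  exact key F.1 F.eq_H τ

theorem H_eq_of_range {σ τ : NormalCone (Partitions X)}
    (h : Set.range (toMap σ) = Set.range (toMap τ)) : H σ = H τ := by
  refine ConeFunctor.ext_of_eq (fun p => ?_) fun {p q} g x y hxy => ?_
  · ext τ
    rw [mem_H_iff, mem_H_iff, h]
  · refine toMap_injective (funext fun z => ?_)
    obtain ⟨w, hw⟩ := Quotient.exists_rep (Partitions.toFun g (Quotient.mk _ z))
    rw [toMap_H_map σ g x hw.symm, toMap_H_map τ g y hw.symm, hxy]

/-- Every non-empty proper subset is the range of an idempotent cone. -/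
theorem exists_idempotent (A : Powerset X) :
    ∃ ε : NormalCone (Partitions X), IsIdempotentElem ε ∧ Set.range (toMap ε) = A.carrier := by
  classical
  obtain ⟨a₀, ha₀⟩ := A.nonempty
  let a : X → X := fun x => if x ∈ A.carrier then x else a₀
  have ha : ∀ x ∈ A.carrier, a x = x := fun x hx => if_pos hx
  have ha' : ∀ x, a x ∈ A.carrier := fun x => by
    dsimp only [a]
    split_ifs with h
    · exact h
    · exact ha₀
  have hr : Set.range a = A.carrier := by
    refine Set.Subset.antisymm ?_ fun x hx => ⟨x, ha x hx⟩
    rintro _ ⟨x, rfl⟩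
    exact ha' x
  have h2 : ¬ Function.Surjective a := fun h => A.ne_univ (by rw [← hr, Set.range_eq_univ.2 h])
  have h1 : ¬ Function.Injective a := fun h => h2 fun x => ⟨x, h (ha _ (ha' x))⟩
  refine ⟨ofMap a h1 h2, toMap_injective ?_, by rw [toMap_ofMap, hr]⟩
  rw [toMap_mul, toMap_ofMap]
  exact funext fun x => ha _ (ha' x)

theorem hom_ext_toMap {F G : NormalDual (Partitions X)} {s t : F ⟶ G}
    (h : ∀ p τ x, toMap (appl s p τ).1 x = toMap (appl t p τ).1 x) :
    s = t :=
  hom_ext fun p τ => Subtype.ext (toMap_injective (funext (h p τ)))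

variable [Nontrivial X]

/-- The subset corresponding to an object of the normal dual of the category of partitions. -/
noncomputable def subset (F : NormalDual (Partitions X)) : Powerset X where
  carrier := Set.range (toMap F.gen)
  nonempty := Set.range_nonempty _
  ne_univ h := toMap_not_surjective _ (Set.range_eq_univ.1 h)

theorem mem_iff {F : NormalDual (Partitions X)} {p : Partitions X}
    {τ : NormalCone (Partitions X)} :
    τ ∈ F.1.obj p ↔
      Set.range (toMap τ) ⊆ (subset F).carrier ∧ p.rel ≤ Setoid.ker (toMap τ) := by
  rw [F.eq_H]
  exact mem_H_iff

theorem mem_subset {F : NormalDual (Partitions X)} {p : Partitions X} (τ : F.1.obj p) (x : X) :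
    toMap τ.1 x ∈ (subset F).carrier := (mem_iff.1 τ.2).1 ⟨x, rfl⟩

theorem toMap_eq_of_rel {F : NormalDual (Partitions X)} {p : Partitions X} (τ : F.1.obj p)
    {x y : X} (h : p.rel x y) : toMap τ.1 x = toMap τ.1 y := (mem_iff.1 τ.2).2 h

theorem subset_carrier_eq {F : NormalDual (Partitions X)} {σ : NormalCone (Partitions X)}
    (h : F.1 = H σ) : (subset F).carrier = Set.range (toMap σ) := by
  have h1 : σ ∈ F.1.obj σ.vertex := by
    rw [h, mem_H_iff]
    exact ⟨le_rfl, (ker_toMap σ).ge⟩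
  have h2 : F.gen ∈ (H σ).obj F.gen.vertex := by
    rw [← h, F.eq_H, mem_H_iff]
    exact ⟨le_rfl, (ker_toMap _).ge⟩
  exact le_antisymm (mem_H_iff.1 h2).1 (mem_iff.1 h1).1

theorem subset_injective : Function.Injective (subset (X := X)) := fun F G h =>
  Subtype.ext (by rw [F.eq_H, G.eq_H]; exact H_eq_of_range (congrArg Powerset.carrier h))

theorem subobjOf_iff {F G : NormalDual (Partitions X)} :
    SubobjOf F G ↔ (subset F).carrier ⊆ (subset G).carrier := by
  constructor
  · rintro ⟨h, -⟩
    have h2 : F.gen ∈ F.1.obj F.gen.vertex := by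
      rw [F.eq_H, mem_H_iff]
      exact ⟨le_rfl, (ker_toMap _).ge⟩
    exact (mem_iff.1 (h _ h2)).1
  · intro h
    refine ⟨fun p τ hτ => ?_, fun {p q} g τ => toMap_injective (funext fun z => ?_)⟩
    · rw [mem_iff] at hτ ⊢
      exact ⟨hτ.1.trans h, hτ.2⟩
    · obtain ⟨w, hw⟩ := Quotient.exists_rep (Partitions.toFun g (Quotient.mk _ z))
      rw [toMap_map F g _ hw.symm, toMap_map G g _ hw.symm]

/-- The object of the normal dual corresponding to a subset. -/
theorem exists_subset_eq (A : Powerset X) : ∃ F : NormalDual (Partitions X), subset F = A := by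
  obtain ⟨ε, h, hA⟩ := exists_idempotent A
  exact ⟨⟨H ε, ε, h, rfl⟩, Powerset.ext ((subset_carrier_eq (σ := ε) rfl).trans hA)⟩

theorem mem_MSet_iff {F : NormalDual (Partitions X)} {p : Partitions X} :
    p ∈ MSet F ↔ ∀ x, ∃! a, a ∈ (subset F).carrier ∧ p.rel a x := by
  constructor
  · rintro ⟨σ, hσ, h⟩
    rw [subset_carrier_eq hσ]
    exact (isIso_app_iff σ p).1 h
  · intro h
    exact ⟨_, F.eq_H, (isIso_app_iff _ p).2 h⟩

end PartitionDual

end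

section

variable {X : Type u}

/-! ### Cross-connections from the partitions to the powerset category -/

variable [Nontrivial X]

/-- The cone of the constant map with value `z`. -/
noncomputable def PowersetCone.const (z : X) : NormalCone (Powerset X) :=
  ofMap (fun _ => z)
    (fun h => by
      obtain ⟨a, b, hab⟩ := exists_pair_ne X
      exact hab (h rfl))
    (fun h => by
      obtain ⟨y, hy⟩ := exists_ne z
      obtain ⟨_, rfl⟩ := h y
      exact hy rfl)

theorem PowersetCone.toMap_const (z : X) : toMap (const z) = fun _ => z := rfl

/-- The partition with one block. -/
def Partitions.top : Partitions X where
  rel := ⊤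
  ne_bot h := by
    obtain ⟨a, b, hab⟩ := exists_pair_ne X
    have : (⊤ : Setoid X) a b := trivial
    rw [h] at this
    exact hab this

/-- The morphism from a partition to the partition with one block given by the block of `x`. -/
def Partitions.toTop (p : Partitions X) (x : X) : p ⟶ Partitions.top :=
  fun _ => Quotient.mk p.rel x

theorem Partitions.toTop_eq_iff {p : Partitions X} {x y : X} :
    p.toTop x = p.toTop y ↔ p.rel x y := by
  constructor
  · intro h
    exact Quotient.exact (congrFun h (Quotient.mk _ x))
  · intro h
    exact funext fun _ => Quotient.sound h

theorem Partitions.exists_eq_toTop {p : Partitions X} (f : p ⟶ Partitions.top) :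
    ∃ x, f = p.toTop x := by
  obtain ⟨x, hx⟩ := Quotient.exists_rep (Partitions.toFun f (Quotient.mk _ (Classical.arbitrary X)))
  refine ⟨x, funext fun q => ?_⟩
  obtain ⟨y, rfl⟩ := Quotient.exists_rep q
  refine Eq.trans ?_ hx.symm
  exact congrArg (Partitions.toFun f) (Quotient.sound (s := ⊤) trivial)

theorem Partitions.incl_toTop {p q : Partitions X} (h : SubobjOf q p) (x : X) :
    incl h ≫ p.toTop x = q.toTop x := rfl

section

open PowersetDual PowersetCone NormalDual

variable {Γ : Partitions X ⥤ NormalDual (Powerset X)}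

theorem IsLocalIso.part_top (hΓ : IsLocalIso Γ) : (part (Γ.obj Partitions.top)).rel = ⊤ := by
  obtain ⟨F, hF⟩ := exists_part_eq (Partitions.top (X := X))
  have h : SubobjOf F (Γ.obj Partitions.top) := by
    rw [subobjOf_iff, hF]
    exact le_top
  obtain ⟨p, hp, hpF⟩ := (hΓ.ideal Partitions.top).surjOn h
  obtain rfl : p = Partitions.top := Partitions.ext (top_le_iff.1 hp)
  rw [hpF, hF]
  rfl

theorem const_mem (F : NormalDual (Powerset X)) {A : Powerset X} {a : X} (ha : a ∈ A.carrier) :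
    const a ∈ F.1.obj A :=
  mem_iff.2 ⟨by
    rw [toMap_const]
    rintro _ ⟨_, rfl⟩
    exact ha, fun _ _ _ => rfl⟩

theorem map_const (F : NormalDual (Powerset X)) {A B : Powerset X} (g : A ⟶ B) (a : A.carrier) :
    F.1.map g ⟨const a, const_mem F a.2⟩ =
      ⟨const (Powerset.toFun g a), const_mem F (Powerset.toFun g a).2⟩ := by
  refine Subtype.ext (toMap_injective (funext fun z => ?_))
  rw [toMap_map]
  rfl

/-- Evaluation at `y`, as a morphism of the normal dual. -/
noncomputable def evalHom (Γ : Partitions X ⥤ NormalDual (Powerset X)) (p : Partitions X) (y : X) :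
    Γ.obj p ⟶ Γ.obj Partitions.top :=
  homMk (fun _ δ => ⟨const (toMap δ.1 y), const_mem _ (mem_carrier δ y)⟩)
    fun {A B} g δ => by
      rw [map_const _ g ⟨toMap δ.1 y, mem_carrier δ y⟩]
      exact Subtype.ext (congrArg const (toMap_map (Γ.obj p) g δ y))

theorem appl_evalHom (p : Partitions X) (y : X) (A : Powerset X)
    (δ : (Γ.obj p).1.obj A) :
    (appl (evalHom Γ p y) A δ : NormalCone (Powerset X)) = const (toMap δ.1 y) := rfl

theorem gen_mem (F : NormalDual (Powerset X)) : F.gen ∈ F.1.obj F.gen.vertex :=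
  mem_iff.2 ⟨(range_toMap _).subset, le_rfl⟩

theorem evalHom_eq_iff {p : Partitions X} {y z : X} :
    evalHom Γ p y = evalHom Γ p z ↔ (part (Γ.obj p)).rel y z := by
  constructor
  · intro h
    have h1 := congrArg (fun t => (appl t _ ⟨_, gen_mem (Γ.obj p)⟩ : NormalCone (Powerset X))) h
    rw [appl_evalHom, appl_evalHom] at h1
    have h2 := congrArg (fun γ => toMap γ y) h1
    exact h2
  · intro h
    refine hom_ext fun A δ => Subtype.ext ?_
    rw [appl_evalHom, appl_evalHom]
    exact congrArg const ((mem_iff.1 δ.2).2 h)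

theorem exists_eq_evalHom (hΓ : IsLocalIso Γ) {p : Partitions X}
    (t : Γ.obj p ⟶ Γ.obj Partitions.top) : ∃ y, t = evalHom Γ p y := by
  let F := Γ.obj p
  let δ₀ : F.1.obj F.gen.vertex := ⟨_, gen_mem F⟩
  have hc : ∀ (A : Powerset X) (ε : (Γ.obj Partitions.top).1.obj A) (z z' : X),
      toMap ε.1 z = toMap ε.1 z' := fun A ε z z' => by
    refine (mem_iff.1 ε.2).2 ?_
    rw [hΓ.part_top]
    trivial
  have hz := mem_carrier (appl t _ δ₀) (Classical.arbitrary X)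
  obtain ⟨y, hy⟩ := (range_toMap F.gen).superset hz
  refine ⟨y, hom_ext fun A δ => Subtype.ext (toMap_injective (funext fun z => ?_))⟩
  rw [appl_evalHom, toMap_const]
  have hs : ∀ v : F.gen.vertex.carrier, ∃ x, toMap F.gen x = v := fun v =>
    (range_toMap F.gen).superset v.2
  choose s hs using hs
  let g : F.gen.vertex ⟶ A := fun v => (⟨toMap δ.1 (s v), mem_carrier δ _⟩ : A.carrier)
  have hg : F.1.map g δ₀ = δ := by
    refine Subtype.ext (toMap_injective (funext fun w => ?_))
    rw [toMap_map]
    exact (mem_iff.1 δ.2).2 (hs _)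
  rw [← hg, appl_map, toMap_map, toMap_map]
  refine congrArg (fun v => (Powerset.toFun g v).1) (Subtype.ext ?_)
  exact (hc _ _ _ _).trans hy.symm

theorem part_rel_iff (hΓ : IsLocalIso Γ) {f : X → X}
    (hf : ∀ p y, Γ.map (p.toTop (f y)) = evalHom Γ p y) {p : Partitions X} {y z : X} :
    (part (Γ.obj p)).rel y z ↔ p.rel (f y) (f z) := by
  have := hΓ.faithful
  rw [← evalHom_eq_iff, ← hf, ← hf, ← Partitions.toTop_eq_iff]
  exact ⟨fun h => Γ.map_injective h, fun h => congrArg _ h⟩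

/-- The cross-connections from the category of partitions to the powerset category are given by
permutations of `X`. -/
theorem IsCrossConnection.exists_perm [h4 : Fact (HasFour X)] (hΓ : IsCrossConnection Γ) :
    ∃ f : Equiv.Perm X, ∀ p y, Γ.map (p.toTop (f y)) = evalHom Γ p y := by
  have hl := hΓ.isLocalIso
  have hfull := hl.full
  have hfaith := hl.faithful
  have h1 : ∀ y, ∃ x, ∀ p : Partitions X, Γ.map (p.toTop x) = evalHom Γ p y := by
    intro y
    have h2 : ∀ p : Partitions X, ∃ x, Γ.map (p.toTop x) = evalHom Γ p y := by
      intro p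
      obtain ⟨t, ht⟩ := Γ.map_surjective (evalHom Γ p y)
      obtain ⟨x, rfl⟩ := Partitions.exists_eq_toTop t
      exact ⟨x, ht⟩
    choose b hb using h2
    have hthread : IsThread fun p : Partitions X => Quotient.mk p.rel (b p) := by
      intro p q h
      have hqp : SubobjOf q p := h
      obtain ⟨h', hi⟩ := hl.map_incl hqp
      have h3 : q.toTop (b p) = q.toTop (b q) := by
        apply Γ.map_injective
        rw [hb q, ← Partitions.incl_toTop hqp, Γ.map_comp, hb p, hi]
        rfl
      exact Quotient.sound (Partitions.toTop_eq_iff.1 h3)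
    obtain ⟨x, hx⟩ := hthread.exists_point h4.out
    refine ⟨x, fun p => ?_⟩
    rw [← hb p]
    exact congrArg Γ.map (Partitions.toTop_eq_iff.2 (Quotient.exact (hx p).symm))
  choose f hf using h1
  have hrel := fun (p : Partitions X) (y z : X) =>
    part_rel_iff hl (fun p y => hf y p) (p := p) (y := y) (z := z)
  have hinj : Function.Injective f := by
    intro y z hyz
    by_contra hne
    obtain ⟨w, hwy, hwz, -⟩ := h4.out.exists_ne y z y
    let A : Powerset X := ⟨{w}ᶜ, ⟨y, hwy.symm⟩, fun h => (h ▸ Set.mem_univ w : w ∈ ({w}ᶜ : Set X)) rfl⟩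
    obtain ⟨p, hp⟩ := hΓ.total A
    rw [mem_MSet_iff] at hp
    refine hne ((hp z).unique ⟨hwy.symm, ?_⟩ ⟨hwz.symm, (part (Γ.obj p)).rel.refl _⟩)
    rw [hrel, hyz]
  have hsurj : Function.Surjective f := by
    intro x
    by_contra! h
    obtain ⟨a, ha, -, -⟩ := h4.out.exists_ne x x x
    obtain ⟨b, hb, hba, -⟩ := h4.out.exists_ne x a x
    let p := pairPartition a b hba.symm
    obtain ⟨y, hy⟩ := exists_eq_evalHom hl (Γ.map (p.toTop x))
    rw [← hf] at hy
    have h2 := Partitions.toTop_eq_iff.1 (Γ.map_injective hy)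
    rw [pairPartition_rel] at h2
    have := h y
    grind
  exact ⟨Equiv.ofBijective f ⟨hinj, hsurj⟩, fun p y => hf y p⟩

/-- The action of a cross-connection on morphisms, in terms of the permutation of `X`. -/
theorem toMap_appl_map {f : Equiv.Perm X}
    (hf : ∀ p y, Γ.map (p.toTop (f y)) = evalHom Γ p y) {p q : Partitions X} (g : p ⟶ q)
    {y z : X} (h : Partitions.toFun g (Quotient.mk _ (f z)) = Quotient.mk _ (f y))
    {A : Powerset X} (δ : (Γ.obj p).1.obj A) :
    toMap (appl (Γ.map g) A δ).1 z = toMap δ.1 y := by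
  have h1 : g ≫ q.toTop (f z) = p.toTop (f y) := funext fun _ => h
  have h2 := congrArg Γ.map h1
  rw [Γ.map_comp, hf, hf] at h2
  have h3 := congrArg (fun t => (appl t A δ : NormalCone (Powerset X))) h2
  rw [appl_comp, appl_evalHom, appl_evalHom] at h3
  exact congrFun (congrArg toMap h3) z

end

end

section

section Component

variable {C D : Type u} [SmallCategory C] [SubobjectCategory C] [NormalCategory C]
  [SmallCategory D] [SubobjectCategory D] [NormalCategory D]

theorem component_naturality {Γ : D ⥤ NormalDual C} {Δ : C ⥤ NormalDual D}
    (χ : bifunctor Γ ≅ dualBifunctor Δ) {c c' : C} {d d' : D} (g : c ⟶ c') (h : d ⟶ d')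
    (γ : (Γ.obj d).1.obj c) :
    component χ c' d' (NormalDual.appl (Γ.map h) c' ((Γ.obj d).1.map g γ)) =
      (Δ.obj c').1.map h (NormalDual.appl (Δ.map g) d (component χ c d γ)) :=
  congrArg (fun t => t γ) (χ.hom.naturality (X := (c, d)) (Y := (c', d')) (Prod.mkHom g h))

/-- A natural isomorphism of bifunctors from its components. -/
noncomputable def isoMk {Γ : D ⥤ NormalDual C} {Δ : C ⥤ NormalDual D}
    (e : ∀ c d, (Γ.obj d).1.obj c ≃ (Δ.obj c).1.obj d)
    (h : ∀ {c c' : C} {d d' : D} (g : c ⟶ c') (k : d ⟶ d') (γ : (Γ.obj d).1.obj c),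
      e c' d' (NormalDual.appl (Γ.map k) c' ((Γ.obj d).1.map g γ)) =
        (Δ.obj c').1.map k (NormalDual.appl (Δ.map g) d (e c d γ))) :
    bifunctor Γ ≅ dualBifunctor Δ :=
  NatIso.ofComponents (fun x => (e x.1 x.2).toIso) fun {x y} k => by
    ext γ
    exact h k.1 k.2 γ

end Component

variable {X : Type u} [Nontrivial X]

theorem mem_MSet_iff_of_perm {Γ : Partitions X ⥤ NormalDual (Powerset X)} (hΓ : IsLocalIso Γ)
    {f : Equiv.Perm X} (hf : ∀ p y, Γ.map (p.toTop (f y)) = evalHom Γ p y) {A : Powerset X}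
    {p : Partitions X} :
    A ∈ MSet (Γ.obj p) ↔ ∀ x, ∃! a, a ∈ f '' A.carrier ∧ p.rel a x := by
  rw [PowersetDual.mem_MSet_iff]
  simp only [part_rel_iff hΓ hf]
  refine f.forall_congr fun {x} => ?_
  constructor
  · rintro ⟨a, ⟨ha, h⟩, hu⟩
    refine ⟨f a, ⟨⟨a, ha, rfl⟩, h⟩, ?_⟩
    rintro _ ⟨⟨b, hb, rfl⟩, hbx⟩
    rw [hu b ⟨hb, hbx⟩]
  · rintro ⟨_, ⟨⟨a, ha, rfl⟩, h⟩, hu⟩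
    exact ⟨a, ⟨ha, h⟩, fun b hb => f.injective (hu (f b) ⟨⟨b, hb.1, rfl⟩, hb.2⟩)⟩

/-- A semigroup of pairs of cones is isomorphic to the semigroup of singular transformations, if
every cone in the powerset category is the first component of exactly one pair. -/
theorem nonempty_mulEquiv_sing {M : Type*} [Mul M] (S : Subsemigroup (NormalCone (Powerset X) × M))
    (hinj : ∀ x x', x ∈ S → x' ∈ S → x.1 = x'.1 → x = x') (hsurj : ∀ γ, ∃ δ, (γ, δ) ∈ S) :
    Nonempty (S ≃* Sing X) := by
  let φ : S →ₙ* Sing X :=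
    { toFun := fun x => ⟨PowersetCone.toMap x.1.1, PowersetCone.toMap_not_injective _,
        PowersetCone.toMap_not_surjective _⟩
      map_mul' := fun x y => Subtype.ext (PowersetCone.toMap_mul x.1.1 y.1.1) }
  refine ⟨MulEquiv.ofBijective φ ⟨fun x x' h => ?_, fun a => ?_⟩⟩
  · exact Subtype.ext (hinj _ _ x.2 x'.2
      (PowersetCone.toMap_injective (congrArg Subtype.val h)))
  · obtain ⟨δ, hδ⟩ := hsurj (PowersetCone.ofMap a.1 a.2.1 a.2.2)
    exact ⟨⟨_, hδ⟩, rfl⟩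

variable [h4 : Fact (HasFour X)]

/-! ### The duals of a cross-connection -/

section

open PartitionDual

variable {Δ : Powerset X ⥤ NormalDual (Partitions X)}

theorem IsLocalIso.exists_subset_obj_eq_image (hΔ : IsLocalIso Δ) :
    ∃ g : X → X, ∀ A, (subset (Δ.obj A)).carrier = g '' A.carrier := by
  have hmono : ∀ {A B : Powerset X}, A.carrier ⊆ B.carrier →
      (subset (Δ.obj A)).carrier ⊆ (subset (Δ.obj B)).carrier := fun {A B} h =>
    subobjOf_iff.1 (hΔ.map_incl (show SubobjOf A B from h)).1
  have hbelow : ∀ (A : Powerset X) (s : X), s ∈ (subset (Δ.obj A)).carrier →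
      ∃ B : Powerset X, B.carrier ⊆ A.carrier ∧ (subset (Δ.obj B)).carrier = {s} := by
    intro A s hs
    obtain ⟨F, hF⟩ := exists_subset_eq (Powerset.point s)
    have hFA : SubobjOf F (Δ.obj A) := by
      rw [subobjOf_iff, hF]
      exact Set.singleton_subset_iff.2 hs
    obtain ⟨B, hB, rfl⟩ := (hΔ.ideal A).surjOn hFA
    exact ⟨B, hB, by rw [hF]; rfl⟩
  have hpoint : ∀ x, ∃ s, (subset (Δ.obj (Powerset.point x))).carrier = {s} := by
    intro x
    obtain ⟨s, hs⟩ := (subset (Δ.obj (Powerset.point x))).nonempty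
    obtain ⟨B, hB, hBs⟩ := hbelow _ s hs
    have : B = Powerset.point x :=
      Powerset.ext (B.nonempty.subset_singleton_iff.1 hB)
    rw [this] at hBs
    exact ⟨s, hBs⟩
  choose g hg using hpoint
  refine ⟨g, fun A => Set.Subset.antisymm (fun s hs => ?_) ?_⟩
  · obtain ⟨B, hB, hBs⟩ := hbelow A s hs
    obtain ⟨b, hb⟩ := B.nonempty
    have h1 := hmono (A := Powerset.point b) (Set.singleton_subset_iff.2 hb)
    rw [hg, hBs, Set.singleton_subset_singleton] at h1
    exact ⟨b, hB hb, h1⟩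
  · rintro _ ⟨a, ha, rfl⟩
    have h1 := hmono (A := Powerset.point a) (Set.singleton_subset_iff.2 ha)
    rw [hg] at h1
    exact h1 rfl

theorem IsDualOf.subset_obj {Γ : Partitions X ⥤ NormalDual (Powerset X)} (hΓ : IsLocalIso Γ)
    {f : Equiv.Perm X} (hf : ∀ p y, Γ.map (p.toTop (f y)) = evalHom Γ p y)
    (hΔ : IsDualOf Δ Γ) (A : Powerset X) : (subset (Δ.obj A)).carrier = f '' A.carrier := by
  obtain ⟨g, hg⟩ := hΔ.isCrossConnection.isLocalIso.exists_subset_obj_eq_image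
  let compl : X → Powerset X := fun x => ⟨{x}ᶜ, by
    obtain ⟨y, hy⟩ := exists_ne x
    exact ⟨y, hy⟩, fun h => (h ▸ Set.mem_univ x : x ∈ ({x}ᶜ : Set X)) rfl⟩
  have hmem : ∀ x a, a ∈ f '' (compl x).carrier ↔ a ≠ f x := by
    intro x a
    constructor
    · rintro ⟨b, hb, rfl⟩ h
      exact hb (f.injective h)
    · intro h
      exact ⟨f.symm a, fun h' => h (by rw [← h', f.apply_symm_apply]), f.apply_symm_apply a⟩
  have hcross : ∀ (x w : X) (hw : f x ≠ w) (u : X), ∃! a, a ∈ g '' (compl x).carrier ∧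
      (pairPartition (f x) w hw).rel a u := by
    intro x w hw
    rw [← hg, ← PartitionDual.mem_MSet_iff, ← hΔ.mem_MSet_iff, mem_MSet_iff_of_perm hΓ hf]
    intro u
    simp only [hmem, pairPartition_rel]
    by_cases hu : u = f x ∨ u = w
    · exact ⟨w, by grind, by grind⟩
    · exact ⟨u, by grind, by grind⟩
  have hself : ∀ x, f x ∉ g '' (compl x).carrier := by
    intro x hx
    obtain ⟨w, hw, -⟩ := h4.out.exists_ne (f x) (f x) (f x)
    obtain ⟨v, hv, hvw, -⟩ := h4.out.exists_ne (f x) w w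
    obtain ⟨a, ⟨ha, har⟩, -⟩ := hcross x w hw.symm v
    rw [pairPartition_rel] at har
    obtain rfl : a = v := by grind
    refine hv ((hcross x a hv.symm (f x)).unique ⟨ha, ?_⟩ ⟨hx, ?_⟩) <;>
    · rw [pairPartition_rel]
      simp
  have hgf : g = f := by
    funext x
    obtain ⟨y, hy, -⟩ := h4.out.exists_ne x x x
    have hfy : f y ≠ f x := fun h => hy (f.injective h)
    obtain ⟨w, hw, hw', -⟩ := h4.out.exists_ne (f x) (f y) (f y)
    obtain ⟨a, ⟨⟨b, -, rfl⟩, har⟩, -⟩ := hcross y w hw'.symm (f x)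
    rw [pairPartition_rel] at har
    have hb : g b = f x := by grind
    by_cases hbx : b = x
    · rw [← hbx, hb, hbx]
    · exact absurd ⟨b, hbx, hb⟩ (hself x)
  rw [hg, hgf]

/-- A duality conjugates the transformations by the permutation of `X`. -/
theorem toMap_component {Γ : Partitions X ⥤ NormalDual (Powerset X)} (hΓ : IsLocalIso Γ)
    {f : Equiv.Perm X} (hf : ∀ p y, Γ.map (p.toTop (f y)) = evalHom Γ p y)
    (hΔ : IsDualOf Δ Γ) (χ : bifunctor Γ ≅ dualBifunctor Δ) {A : Powerset X} {p : Partitions X}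
    (γ : (Γ.obj p).1.obj A) (y : X) :
    PartitionCone.toMap (component χ A p γ).1 (f y) = f (PowersetCone.toMap γ.1 y) := by
  have h1 := component_naturality χ (𝟙 A) (p.toTop (f y)) γ
  rw [(Γ.obj p).1.map_id, hf, Δ.map_id] at h1
  have h2 := congrArg (fun τ => PartitionCone.toMap τ.1 y) h1
  rw [toMap_map (Δ.obj A) (p.toTop (f y)) (y := f y) _ rfl] at h2
  refine Eq.trans h2.symm ?_
  have ha := PowersetDual.mem_carrier γ y
  generalize hav : PowersetCone.toMap γ.1 y = a at ha
  have hsub : SubobjOf (Powerset.point a) A := Set.singleton_subset_iff.2 ha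
  let κ : (Γ.obj Partitions.top).1.obj (Powerset.point a) :=
    ⟨PowersetCone.const a, const_mem _ (Set.mem_singleton a)⟩
  have h3 := component_naturality χ (incl hsub) (𝟙 Partitions.top) κ
  have h4 : NormalDual.appl (evalHom Γ p y) A γ =
      NormalDual.appl (Γ.map (𝟙 Partitions.top)) A
        ((Γ.obj Partitions.top).1.map (incl hsub) κ) := by
    rw [Γ.map_id]
    refine Subtype.ext (PowersetCone.toMap_injective (funext fun z => ?_))
    rw [appl_evalHom]
    refine Eq.trans ?_ (PowersetDual.toMap_map _ (incl hsub) κ z).symm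
    exact hav
  rw [h4, h3, (Δ.obj A).1.map_id]
  obtain ⟨h', hi⟩ := hΔ.isCrossConnection.isLocalIso.map_incl hsub
  rw [hi]
  have h5 := mem_subset (component χ _ _ κ) y
  rw [hΔ.subset_obj hΓ hf] at h5
  obtain ⟨b, hb, hbf⟩ := h5
  obtain rfl : b = a := hb
  exact hbf.symm

/-- The cones are linked exactly if their transformations are conjugate. -/
theorem mem_linkedPairs_iff {Γ : Partitions X ⥤ NormalDual (Powerset X)} (hΓ : IsLocalIso Γ)
    {f : Equiv.Perm X} (hf : ∀ p y, Γ.map (p.toTop (f y)) = evalHom Γ p y)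
    (hΔ : IsDualOf Δ Γ) (χ : bifunctor Γ ≅ dualBifunctor Δ)
    {x : NormalCone (Powerset X) × (NormalCone (Partitions X))ᵐᵒᵖ} :
    x ∈ linkedPairs χ ↔
      ∀ y, PartitionCone.toMap x.2.unop (f y) = f (PowersetCone.toMap x.1 y) := by
  constructor
  · rintro ⟨-, -, A, p, h, hx⟩ y
    rw [hx]
    exact toMap_component hΓ hf hΔ χ ⟨x.1, h⟩ y
  · intro h
    have hne : (Setoid.ker (PowersetCone.toMap x.1)).comap f.symm ≠ ⊥ := by
      intro hbot
      refine PowersetCone.toMap_not_injective x.1 fun y z hyz => f.injective ?_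
      have h1 : (Setoid.ker (PowersetCone.toMap x.1)).comap f.symm (f y) (f z) := by
        rw [Setoid.comap_rel, f.symm_apply_apply, f.symm_apply_apply]
        exact hyz
      rw [hbot] at h1
      exact h1
    let p : Partitions X := ⟨_, hne⟩
    have hx : x.1 ∈ (Γ.obj p).1.obj x.1.vertex := by
      refine PowersetDual.mem_iff.2 ⟨(PowersetCone.range_toMap _).subset, fun {y z} hyz => ?_⟩
      have h1 := (part_rel_iff hΓ hf).1 hyz
      rwa [Setoid.comap_rel, f.symm_apply_apply, f.symm_apply_apply] at h1
    have h2 : x.2.unop = component χ x.1.vertex p ⟨x.1, hx⟩ := by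
      refine PartitionCone.toMap_injective (funext fun y => ?_)
      obtain ⟨y, rfl⟩ := f.surjective y
      rw [toMap_component hΓ hf hΔ χ, h]
    refine ⟨Set.mem_iUnion₂.2 ⟨_, p, hx⟩, Set.mem_iUnion₂.2 ⟨p, x.1.vertex, ?_⟩, _, p, hx, h2⟩
    rw [h2]
    exact Subtype.prop _

theorem exists_subsemigroup {Γ : Partitions X ⥤ NormalDual (Powerset X)} (hΓ : IsLocalIso Γ)
    {f : Equiv.Perm X} (hf : ∀ p y, Γ.map (p.toTop (f y)) = evalHom Γ p y)
    (hΔ : IsDualOf Δ Γ) (χ : bifunctor Γ ≅ dualBifunctor Δ) :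
    ∃ S : Subsemigroup (NormalCone (Powerset X) × (NormalCone (Partitions X))ᵐᵒᵖ),
      (S : Set (NormalCone (Powerset X) × (NormalCone (Partitions X))ᵐᵒᵖ)) = linkedPairs χ ∧
      Nonempty (S ≃* Sing X) := by
  have hiff {x} := mem_linkedPairs_iff hΓ hf hΔ χ (x := x)
  let S : Subsemigroup (NormalCone (Powerset X) × (NormalCone (Partitions X))ᵐᵒᵖ) :=
    { carrier := linkedPairs χ
      mul_mem' := by
        intro x x' h h'
        rw [hiff] at h h' ⊢
        intro y
        rw [Prod.fst_mul, Prod.snd_mul, MulOpposite.unop_mul, PartitionCone.toMap_mul,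
          PowersetCone.toMap_mul, Function.comp_apply, Function.comp_apply, h, h'] }
  refine ⟨S, rfl, nonempty_mulEquiv_sing S (fun x x' hx hx' h => ?_) fun γ => ?_⟩
  · refine Prod.ext h
      (MulOpposite.unop_injective (PartitionCone.toMap_injective (funext fun y => ?_)))
    obtain ⟨y, rfl⟩ := f.surjective y
    rw [hiff.1 hx, hiff.1 hx', h]
  · have h1 : ¬ Function.Injective (f ∘ PowersetCone.toMap γ ∘ f.symm) := fun h =>
      PowersetCone.toMap_not_injective γ (by simpa using h)
    have h2 : ¬ Function.Surjective (f ∘ PowersetCone.toMap γ ∘ f.symm) := fun h =>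
      PowersetCone.toMap_not_surjective γ (by simpa using h)
    refine ⟨MulOpposite.op (PartitionCone.ofMap _ h1 h2), hiff.2 fun y => ?_⟩
    rw [MulOpposite.unop_op, PartitionCone.toMap_ofMap]
    simp

end

end

section

variable {X : Type u} [Nontrivial X]

/-! ### The dual given by a permutation -/

/-- The element of an object of the normal dual of the powerset category given by a map. -/
noncomputable def PowersetDual.elem (F : NormalDual (Powerset X)) (A : Powerset X) (a : X → X)
    (h : ∀ x, a x ∈ A.carrier) (h' : ∀ x y, (part F).rel x y → a x = a y) : F.1.obj A :=
  ⟨PowersetCone.ofMap a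
      (fun hi => (part F).ne_bot (le_bot_iff.1 fun {_ _} hxy => hi (h' _ _ hxy)))
      (fun hs => A.ne_univ (Set.eq_univ_of_forall fun y => by
        obtain ⟨x, rfl⟩ := hs y
        exact h x)),
    mem_iff.2 ⟨by
      rintro _ ⟨x, rfl⟩
      exact h x, fun {x y} hxy => h' x y hxy⟩⟩

variable [h4 : Fact (HasFour X)]

/-- The element of an object of the normal dual of the category of partitions given by a map. -/
noncomputable def PartitionDual.elem (F : NormalDual (Partitions X)) (p : Partitions X)
    (a : X → X) (h : ∀ x, a x ∈ (subset F).carrier) (h' : ∀ x y, p.rel x y → a x = a y) :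
    F.1.obj p :=
  ⟨PartitionCone.ofMap a
      (fun hi => p.ne_bot (le_bot_iff.1 fun {_ _} hxy => hi (h' _ _ hxy)))
      (fun hs => (subset F).ne_univ (Set.eq_univ_of_forall fun y => by
        obtain ⟨x, rfl⟩ := hs y
        exact h x)),
    mem_iff.2 (by
      rw [PartitionCone.toMap_ofMap]
      refine ⟨?_, fun {x y} hxy => h' x y hxy⟩
      rintro _ ⟨x, rfl⟩
      exact h x)⟩

theorem PartitionDual.toMap_elem (F : NormalDual (Partitions X)) (p : Partitions X)
    (a : X → X) (h : ∀ x, a x ∈ (subset F).carrier) (h' : ∀ x y, p.rel x y → a x = a y) :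
    PartitionCone.toMap (elem F p a h h').1 = a := by
  simp only [elem, PartitionCone.toMap_ofMap]

namespace PermDual

open PartitionDual NormalDual

/-- The image of a subset under a permutation, as an object of the normal dual. -/
noncomputable def obj (f : Equiv.Perm X) (A : Powerset X) : NormalDual (Partitions X) :=
  (exists_subset_eq (X := X) ⟨f '' A.carrier, A.nonempty.image f, fun h => A.ne_univ (by
    rw [← f.preimage_image A.carrier, h, Set.preimage_univ])⟩).choose

theorem subset_obj (f : Equiv.Perm X) (A : Powerset X) :
    (subset (obj f A)).carrier = f '' A.carrier :=
  congrArg Powerset.carrier (exists_subset_eq (X := X) _).choose_spec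

theorem symm_mem {f : Equiv.Perm X} {A : Powerset X} {p : Partitions X}
    (τ : (obj f A).1.obj p) (x : X) : f.symm (PartitionCone.toMap τ.1 x) ∈ A.carrier := by
  have h := mem_subset τ x
  rw [subset_obj] at h
  obtain ⟨a, ha, h⟩ := h
  rw [← h, f.symm_apply_apply]
  exact ha

theorem mem_subset_obj (f : Equiv.Perm X) {A : Powerset X} (a : A.carrier) :
    f a ∈ (subset (obj f A)).carrier := by
  rw [subset_obj]
  exact ⟨a, a.2, rfl⟩

/-- The action of a morphism of the powerset category, conjugated by a permutation. -/
noncomputable def mapElem (f : Equiv.Perm X) {A B : Powerset X} (g : A ⟶ B) (p : Partitions X)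
    (τ : (obj f A).1.obj p) : (obj f B).1.obj p :=
  elem _ p (fun x => f (Powerset.toFun g ⟨_, symm_mem τ x⟩)) (fun _ => mem_subset_obj f _)
    fun x y hxy => by
      refine congrArg (fun v => f (Powerset.toFun g v)) (Subtype.ext ?_)
      exact congrArg f.symm (toMap_eq_of_rel τ hxy)

theorem toMap_mapElem (f : Equiv.Perm X) {A B : Powerset X} (g : A ⟶ B) (p : Partitions X)
    (τ : (obj f A).1.obj p) {x : X} {a : A.carrier} (h : PartitionCone.toMap τ.1 x = f a) :
    PartitionCone.toMap (mapElem f g p τ).1 x = f (Powerset.toFun g a) := by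
  unfold mapElem
  rw [toMap_elem]
  refine congrArg (fun v => f (Powerset.toFun g v)) (Subtype.ext ?_)
  exact (f.symm_apply_eq).2 h

theorem exists_toMap_eq {f : Equiv.Perm X} {A : Powerset X} {p : Partitions X}
    (τ : (obj f A).1.obj p) (x : X) : ∃ a : A.carrier, PartitionCone.toMap τ.1 x = f a :=
  ⟨⟨_, symm_mem τ x⟩, (f.apply_symm_apply _).symm⟩

/-- The morphism of the normal dual given by a morphism of the powerset category. -/
noncomputable def map (f : Equiv.Perm X) {A B : Powerset X} (g : A ⟶ B) : obj f A ⟶ obj f B :=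
  homMk (mapElem f g) fun {p q} k τ =>
    Subtype.ext <| PartitionCone.toMap_injective <| funext fun x => by
      obtain ⟨y, hy⟩ := Quotient.exists_rep (Partitions.toFun k (Quotient.mk _ x))
      obtain ⟨a, ha⟩ := exists_toMap_eq τ y
      rw [toMap_map (obj f B) k _ hy.symm, toMap_mapElem f g p τ ha, toMap_mapElem]
      rw [toMap_map (obj f A) k τ hy.symm, ha]

theorem toMap_appl_map (f : Equiv.Perm X) {A B : Powerset X} (g : A ⟶ B) {p : Partitions X}
    {τ : (obj f A).1.obj p} {x : X} {a : A.carrier} (h : PartitionCone.toMap τ.1 x = f a) :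
    PartitionCone.toMap (appl (map f g) p τ).1 x = f (Powerset.toFun g a) :=
  toMap_mapElem f g p τ h

/-- The functor from the powerset category to the normal dual of the category of partitions given
by a permutation. -/
noncomputable def functor (f : Equiv.Perm X) : Powerset X ⥤ NormalDual (Partitions X) where
  obj := obj f
  map := map f
  map_id A := hom_ext_toMap fun p τ x => by
    obtain ⟨a, ha⟩ := exists_toMap_eq τ x
    rw [toMap_appl_map f (𝟙 A) ha]
    exact ha.symm
  map_comp {A B D} g k := hom_ext_toMap fun p τ x => by
    obtain ⟨a, ha⟩ := exists_toMap_eq τ x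
    rw [appl_comp, toMap_appl_map f (g ≫ k) ha, toMap_appl_map f k (toMap_appl_map f g ha)]
    rfl

/-- The constant element of an object. -/
noncomputable def constElem (f : Equiv.Perm X) {A : Powerset X} (p : Partitions X)
    (a : A.carrier) : (obj f A).1.obj p :=
  elem _ p (fun _ => f a) (fun _ => mem_subset_obj f a) fun _ _ _ => rfl

theorem toMap_constElem (f : Equiv.Perm X) {A : Powerset X} (p : Partitions X)
    (a : A.carrier) (x : X) : PartitionCone.toMap (constElem f p a).1 x = f a :=
  congrFun (toMap_elem _ _ _ _ _) x

theorem full (f : Equiv.Perm X) : (functor f).Full where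
  map_surjective {A B} t := by
    change obj f A ⟶ obj f B at t
    let x₀ := Classical.arbitrary X
    let g : A ⟶ B := fun a => (⟨_, symm_mem (appl t Partitions.top (constElem f _ a)) x₀⟩ : B.carrier)
    refine ⟨g, ?_⟩
    change map f g = t
    refine hom_ext_toMap fun p τ x => ?_
    obtain ⟨a, ha⟩ := exists_toMap_eq τ x
    rw [toMap_appl_map f g ha]
    have h1 : constElem f Partitions.top a = (obj f A).1.map (p.toTop x) τ := by
      refine Subtype.ext (PartitionCone.toMap_injective (funext fun z => ?_))
      rw [toMap_constElem, toMap_map (obj f A) (p.toTop x) τ rfl, ha]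
    refine (f.apply_symm_apply _).trans ?_
    rw [h1, appl_map, toMap_map (obj f B) (p.toTop x) _ rfl]

theorem faithful (f : Equiv.Perm X) : (functor f).Faithful where
  map_injective {A B g k} h := by
    funext a
    have h0 : map f g = map f k := h
    have ha := toMap_constElem f (A := A) Partitions.top a (Classical.arbitrary X)
    have h1 := toMap_appl_map f g ha
    rw [h0, toMap_appl_map f k ha] at h1
    exact Subtype.ext (f.injective h1.symm)

theorem isLocalIso (f : Equiv.Perm X) : IsLocalIso (functor f) where
  map_incl {A B} h := by
    have h' : SubobjOf (obj f A) (obj f B) := by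
      rw [subobjOf_iff, subset_obj, subset_obj]
      exact Set.image_mono h
    refine ⟨h', ?_⟩
    change map f (incl h) = _
    refine hom_ext_toMap fun p τ x => ?_
    obtain ⟨a, ha⟩ := exists_toMap_eq τ x
    rw [toMap_appl_map f (incl h) ha]
    exact ha.symm
  full := full f
  faithful := faithful f
  ideal A := by
    refine ⟨fun B hB => ?_, fun B _ B' _ h => ?_, fun F hF => ?_⟩
    · change SubobjOf (obj f B) (obj f A)
      rw [subobjOf_iff, subset_obj, subset_obj]
      exact Set.image_mono hB
    · have h1 := congrArg (fun F => (subset F).carrier) (show obj f B = obj f B' from h)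
      simp only [subset_obj] at h1
      exact Powerset.ext (f.injective.image_injective h1)
    · have h1 : SubobjOf F (obj f A) := hF
      rw [subobjOf_iff, subset_obj] at h1
      let B : Powerset X := ⟨f ⁻¹' (subset F).carrier, by
          obtain ⟨x, hx⟩ := (subset F).nonempty
          exact ⟨f.symm x, by rwa [Set.mem_preimage, f.apply_symm_apply]⟩, fun h =>
        (subset F).ne_univ (by rw [← f.image_preimage (subset F).carrier, h, Set.image_univ,
          f.range_eq_univ])⟩
      have hB : f '' B.carrier = (subset F).carrier := f.image_preimage _
      refine ⟨B, ?_, subset_injective (Powerset.ext ((subset_obj f B).trans hB))⟩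
      change B.carrier ⊆ A.carrier
      rwa [← Set.image_subset_image_iff f.injective, hB]

variable {Γ : Partitions X ⥤ NormalDual (Powerset X)}

theorem isDualOf (hΓ : IsLocalIso Γ) {f : Equiv.Perm X}
    (hf : ∀ p y, Γ.map (p.toTop (f y)) = evalHom Γ p y) : IsDualOf (functor f) Γ := by
  have key : ∀ (A : Powerset X) (p : Partitions X),
      A ∈ MSet (Γ.obj p) ↔ p ∈ MSet ((functor f).obj A) := by
    intro A p
    change _ ↔ p ∈ MSet (obj f A)
    rw [mem_MSet_iff_of_perm hΓ hf, mem_MSet_iff, subset_obj]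
  refine ⟨⟨isLocalIso f, fun p => ?_⟩, key⟩
  obtain ⟨A, hA⟩ := (Γ.obj p).gen.exists_isIso
  exact ⟨A, (key A p).1 ⟨_, (Γ.obj p).eq_H, hA⟩⟩

/-- Conjugation by the permutation. -/
noncomputable def conj (hΓ : IsLocalIso Γ) {f : Equiv.Perm X}
    (hf : ∀ p y, Γ.map (p.toTop (f y)) = evalHom Γ p y) (A : Powerset X) (p : Partitions X) :
    (Γ.obj p).1.obj A ≃ (obj f A).1.obj p where
  toFun γ := elem _ p (fun x => f (PowersetCone.toMap γ.1 (f.symm x)))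
    (fun x => mem_subset_obj f ⟨_, PowersetDual.mem_carrier γ _⟩) fun x y hxy => by
      refine congrArg f ((PowersetDual.mem_iff.1 γ.2).2 ?_)
      rwa [part_rel_iff hΓ hf, f.apply_symm_apply, f.apply_symm_apply]
  invFun τ := PowersetDual.elem _ A (fun x => f.symm (PartitionCone.toMap τ.1 (f x)))
    (fun x => symm_mem τ _) fun x y hxy =>
      congrArg f.symm (toMap_eq_of_rel τ ((part_rel_iff hΓ hf).1 hxy))
  left_inv γ := by
    refine Subtype.ext (PowersetCone.toMap_injective ?_)
    funext x
    refine (f.symm_apply_eq).2 ?_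
    rw [toMap_elem, f.symm_apply_apply]
  right_inv τ := by
    refine Subtype.ext (PartitionCone.toMap_injective ?_)
    rw [toMap_elem]
    funext x
    refine (f.apply_symm_apply _).trans ?_
    rw [f.apply_symm_apply]

theorem toMap_conj (hΓ : IsLocalIso Γ) {f : Equiv.Perm X}
    (hf : ∀ p y, Γ.map (p.toTop (f y)) = evalHom Γ p y) {A : Powerset X} {p : Partitions X}
    (γ : (Γ.obj p).1.obj A) (y : X) :
    PartitionCone.toMap (conj hΓ hf A p γ).1 (f y) = f (PowersetCone.toMap γ.1 y) := by
  simp only [conj, Equiv.coe_fn_mk]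
  rw [toMap_elem, f.symm_apply_apply]

theorem nonempty_iso (hΓ : IsLocalIso Γ) {f : Equiv.Perm X}
    (hf : ∀ p y, Γ.map (p.toTop (f y)) = evalHom Γ p y) :
    Nonempty (bifunctor Γ ≅ dualBifunctor (functor f)) := by
  refine ⟨isoMk (Δ := functor f) (conj hΓ hf) fun {A B p q} g k γ => ?_⟩
  refine Subtype.ext (PartitionCone.toMap_injective (funext fun x => ?_))
  obtain ⟨x, rfl⟩ := f.surjective x
  obtain ⟨y, hy⟩ := Quotient.exists_rep (Partitions.toFun k (Quotient.mk _ (f x)))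
  obtain ⟨y, rfl⟩ := f.surjective y
  refine (toMap_conj hΓ hf _ x).trans ?_
  rw [CrossConnection.toMap_appl_map hf k hy.symm, PowersetDual.toMap_map]
  refine Eq.trans ?_ (toMap_map (obj f B) k _ hy.symm).symm
  exact (toMap_appl_map f g (a := ⟨_, PowersetDual.mem_carrier γ y⟩) (toMap_conj hΓ hf γ y)).symm

end PermDual

end

section

variable {X : Type u}

/-! ### Sets with two elements -/

namespace TwoElements

theorem nonempty_obj [Nontrivial X] (F : NormalDual (Partitions X)) (p : Partitions X) :
    Nonempty (F.1.obj p) := by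
  rw [F.eq_H]
  exact ⟨⟨_, fun _ => Quotient.mk _ (Classical.arbitrary X), rfl⟩⟩

variable (h2 : ∀ x y z : X, x = y ∨ y = z ∨ x = z)

include h2

theorem rel_eq_top (p : Partitions X) : p.rel = ⊤ := by
  obtain ⟨a, b, hab, h⟩ := p.exists_ne
  have key : ∀ z, p.rel z a := by
    intro z
    rcases h2 z a b with rfl | h' | rfl
    · exact p.rel.refl _
    · exact absurd h' hab
    · exact p.rel.symm h
  exact top_le_iff.1 fun x y _ => p.rel.trans (key x) (p.rel.symm (key y))

theorem subsingleton_partitions : Subsingleton (Partitions X) :=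
  ⟨fun p q => Partitions.ext (by rw [rel_eq_top h2, rel_eq_top h2])⟩

theorem subsingleton_blocks (p : Partitions X) : Subsingleton (Quotient p.rel) := by
  refine ⟨fun x y => ?_⟩
  induction x using Quotient.inductionOn
  induction y using Quotient.inductionOn
  exact Quotient.sound (by rw [rel_eq_top h2]; trivial)

theorem subsingleton_partitionCone : Subsingleton (NormalCone (Partitions X)) := by
  refine ⟨fun σ τ => ?_⟩
  have := subsingleton_partitions h2
  obtain ⟨v, a, _, _⟩ := σ
  obtain ⟨w, b, _, _⟩ := τ
  obtain rfl : v = w := Subsingleton.elim _ _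
  have happ : a = b := funext fun p => funext fun _ =>
    (subsingleton_blocks h2 p).elim _ _
  subst happ
  rfl

theorem subsingleton_obj (F : NormalDual (Partitions X)) (p : Partitions X) :
    Subsingleton (F.1.obj p) :=
  ⟨fun _ _ => Subtype.ext ((subsingleton_partitionCone h2).elim _ _)⟩

theorem subsingleton_hom (F G : NormalDual (Partitions X)) : Subsingleton (F ⟶ G) :=
  ⟨fun _ _ => NormalDual.hom_ext fun p _ => (subsingleton_obj h2 G p).elim _ _⟩

theorem subsingleton_normalDual : Subsingleton (NormalDual (Partitions X)) :=
  ⟨fun F G => Subtype.ext (by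
    rw [F.eq_H, G.eq_H, (subsingleton_partitionCone h2).elim F.gen G.gen])⟩

theorem subsingleton_carrier (A : Powerset X) : A.carrier.Subsingleton := by
  intro a ha b hb
  by_contra hab
  refine A.ne_univ (Set.eq_univ_of_forall fun x => ?_)
  rcases h2 x a b with rfl | h | rfl
  · exact ha
  · exact absurd h hab
  · exact hb

theorem eq_of_subset {A B : Powerset X} (h : A.carrier ⊆ B.carrier) : A = B := by
  obtain ⟨a, ha⟩ := A.nonempty
  refine Powerset.ext (Set.Subset.antisymm h fun b hb => ?_)
  rwa [subsingleton_carrier h2 B hb (h ha)]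

theorem isLocalIso (F : NormalDual (Partitions X)) :
    IsLocalIso ((Functor.const (Powerset X)).obj F) where
  map_incl {A B} h := ⟨refl F, (subsingleton_hom h2 F F).elim _ _⟩
  full := ⟨fun {A B} t => ⟨fun _ => ⟨_, B.nonempty.choose_spec⟩, (subsingleton_hom h2 F F).elim _ _⟩⟩
  faithful := ⟨fun {A B g k} _ => funext fun a =>
    Subtype.ext (subsingleton_carrier h2 B (Powerset.toFun g a).2 (Powerset.toFun k a).2)⟩
  ideal A := by
    refine ⟨fun B hB => refl F, fun B hB B' hB' _ => ?_, fun G _ => ⟨A, refl A, ?_⟩⟩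
    · exact (eq_of_subset h2 hB).trans (eq_of_subset h2 hB').symm
    · exact (subsingleton_normalDual h2).elim _ _

variable [Nontrivial X]

theorem mem_MSet_powerset (F : NormalDual (Powerset X)) (A : Powerset X) : A ∈ MSet F := by
  rw [PowersetDual.mem_MSet_iff]
  intro x
  obtain ⟨a, ha⟩ := A.nonempty
  refine ⟨a, ⟨ha, ?_⟩, fun b hb => subsingleton_carrier h2 A hb.1 ha⟩
  rw [rel_eq_top h2]
  trivial

theorem mem_MSet_partitions (F : NormalDual (Partitions X)) (p : Partitions X) : p ∈ MSet F := by
  have := subsingleton_blocks h2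
  exact ⟨F.gen, F.eq_H, Partitions.isIso_of_bijective _
    ⟨fun x y _ => Subsingleton.elim x y,
      fun _ => ⟨Quotient.mk _ (Classical.arbitrary X), Subsingleton.elim _ _⟩⟩⟩

theorem nonempty_normalDual : Nonempty (NormalDual (Partitions X)) := by
  obtain ⟨γ, h, hγ⟩ := NormalCategory.cone (Partitions.top (X := X))
  let σ : NormalCone (Partitions X) := ⟨_, γ, h, _, by rw [hγ]; infer_instance⟩
  exact ⟨⟨H σ, σ, (subsingleton_partitionCone h2).elim _ _, rfl⟩⟩

theorem subsingleton_powerset_obj (F : NormalDual (Powerset X)) (A : Powerset X) :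
    Subsingleton (F.1.obj A) :=
  ⟨fun γ δ => Subtype.ext (PowersetCone.toMap_injective (funext fun x =>
    subsingleton_carrier h2 A (PowersetDual.mem_carrier γ x) (PowersetDual.mem_carrier δ x)))⟩

theorem exists_dual (Γ : Partitions X ⥤ NormalDual (Powerset X)) :
    ∃ Δ : Powerset X ⥤ NormalDual (Partitions X),
      IsDualOf Δ Γ ∧ Nonempty (bifunctor Γ ≅ dualBifunctor Δ) := by
  obtain ⟨F⟩ := nonempty_normalDual h2
  refine ⟨(Functor.const _).obj F, ⟨⟨isLocalIso h2 F, fun p =>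
    ⟨Powerset.point (Classical.arbitrary X), mem_MSet_partitions h2 _ _⟩⟩, fun A p =>
    iff_of_true (mem_MSet_powerset h2 _ _) (mem_MSet_partitions h2 _ _)⟩, ⟨?_⟩⟩
  have hs := subsingleton_obj h2 F
  have hs' := fun p => subsingleton_powerset_obj h2 (Γ.obj p)
  refine isoMk (fun A p =>
    { toFun := fun _ => (nonempty_obj F p).some
      invFun := fun _ => ⟨_, const_mem _ A.nonempty.choose_spec⟩
      left_inv := fun _ => (hs' p A).elim _ _
      right_inv := fun _ => (hs p).elim _ _ }) fun {A B p q} g k γ => (hs q).elim _ _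

theorem exists_subsemigroup {Γ : Partitions X ⥤ NormalDual (Powerset X)}
    {Δ : Powerset X ⥤ NormalDual (Partitions X)} (χ : bifunctor Γ ≅ dualBifunctor Δ) :
    ∃ S : Subsemigroup (NormalCone (Powerset X) × (NormalCone (Partitions X))ᵐᵒᵖ),
      (S : Set (NormalCone (Powerset X) × (NormalCone (Partitions X))ᵐᵒᵖ)) = linkedPairs χ ∧
      Nonempty (S ≃* Sing X) := by
  have hs := subsingleton_partitionCone h2
  refine ⟨⊤, (Set.eq_univ_of_forall fun x => ?_).symm, nonempty_mulEquiv_sing _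
    (fun x x' _ _ h => Prod.ext h (MulOpposite.unop_injective (hs.elim _ _)))
    fun γ => ⟨MulOpposite.op (nonempty_normalDual h2).some.gen, trivial⟩⟩
  have hx : x.1 ∈ (Γ.obj Partitions.top).1.obj x.1.vertex := by
    refine PowersetDual.mem_iff.2 ⟨(PowersetCone.range_toMap _).subset, fun {y z} _ => ?_⟩
    exact subsingleton_carrier h2 _ (PowersetCone.toMap_mem x.1 y) (PowersetCone.toMap_mem x.1 z)
  have hy : x.2.unop = component χ x.1.vertex Partitions.top ⟨x.1, hx⟩ := hs.elim _ _
  refine ⟨Set.mem_iUnion₂.2 ⟨_, _, hx⟩, Set.mem_iUnion₂.2 ⟨Partitions.top, x.1.vertex, ?_⟩,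
    _, _, hx, hy⟩
  rw [hy]
  exact Subtype.prop _

end TwoElements

end

end CrossConnection

open CrossConnection in
theorem mainTheorem3 (X : Type u) [Nontrivial X] (hX : Nat.card X ≠ 3)
    (Γ : Partitions X ⥤ NormalDual (Powerset X)) (hΓ : IsCrossConnection Γ) :
    (∃ Δ : Powerset X ⥤ NormalDual (Partitions X),
      IsDualOf Δ Γ ∧ Nonempty (bifunctor Γ ≅ dualBifunctor Δ)) ∧
    ∀ (Δ : Powerset X ⥤ NormalDual (Partitions X)) (_ : IsDualOf Δ Γ)
      (χ : bifunctor Γ ≅ dualBifunctor Δ),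
      ∃ S : Subsemigroup (NormalCone (Powerset X) × (NormalCone (Partitions X))ᵐᵒᵖ),
        (S : Set (NormalCone (Powerset X) × (NormalCone (Partitions X))ᵐᵒᵖ)) = linkedPairs χ ∧
        Nonempty (S ≃* Sing X) := by
  rcases hasFour_or hX with h4 | h2
  · have : Fact (HasFour X) := ⟨h4⟩
    obtain ⟨f, hf⟩ := hΓ.exists_perm
    exact ⟨⟨_, PermDual.isDualOf hΓ.isLocalIso hf, PermDual.nonempty_iso hΓ.isLocalIso hf⟩,
      fun Δ hΔ χ => exists_subsemigroup hΓ.isLocalIso hf hΔ χ⟩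
  · exact ⟨TwoElements.exists_dual h2 Γ, fun Δ _ χ => TwoElements.exists_subsemigroup h2 χ⟩
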